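/- **Setting.** In the algebraic computation model over the rational numbers ($\mathsf{ACM}\mathbb{Q}$) the computable numbers are those obtained from $\mathbb{Q}$ by finitely many operations $+,-,\times,\div,\sqrt[k]{\phantom{x}}$ ($k\ge 2$); intermediate results may be complex and any complex $k$-th root may be taken. An instance of the weighted region shortest path problem consists of a subdivision of the plane into finitely many closed, possibly unbounded polygonal regions given by rational data, a positive rational weight for each region, and points $s,t\in\mathbb{Q}^2$. The weighted length of a rectifiable path from $s$ to $t$ is the weighted sum of the Euclidean lengths of its parts within the regions (a part running along a common boundary is charged the smallest of the adjacent weights). A shortest path is one of minimum weighted length, and the weighted distance is the infimum of the weighted lengths. The instance is solved exactly in the $\mathsf{ACM}\mathbb{Q}$ if some shortest path is a polygonal chain all of whose vertices have computable coordinates. Let $$\phi(X)=\frac{X}{\sqrt{1-X^2}}+2\,\frac{X/2}{\sqrt{1-(X/2)^2}}+3\,\frac{X/3}{\sqrt{1-(X/3)^2}},$$ $$\begin{aligned}p_{12}(u)={}&419904-3545856u+12394944u^2-24006816u^3+28904608u^4-22882588u^5+12204109u^6\\&-4396586u^7+1060979u^8-168272u^9+16843u^{10}-970u^{11}+25u^{12}.\end{aligned}$$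 **Theorem.** Consider the instance with $s=(0,0)$, $t=(6,2)$ and the regions $\{x\le 1\}$, $\{1\le x\le 3\}$, $\{x\ge 3\}$ of weights $1,2,3$. 1. There is exactly one $\alpha\in[0,1)$ with $\phi(\alpha)=2$. It satisfies $0.60206<\alpha<0.60208$ and $p_{12}(\alpha^2)=0$. The polygonal chain $s,u_1,u_2,t$ with $$u_1=\Bigl(1,\tfrac{\alpha}{\sqrt{1-\alpha^2}}\Bigr),\qquad u_2=\Bigl(3,\tfrac{\alpha}{\sqrt{1-\alpha^2}}+2\tfrac{\alpha/2}{\sqrt{1-(\alpha/2)^2}}\Bigr)$$ is a shortest path, and every shortest path has this chain as its image. 2. The Galois group of $p_{12}$ over $\mathbb{Q}$ is isomorphic to $S_{12}$, which is not solvable. 3. None of $\alpha$, $\alpha^2$, the $y$-coordinate of $u_1$, and the $y$-coordinate of $u_2$ is computable in the $\mathsf{ACM}\mathbb{Q}$. 4. This instance cannot be solved exactly in the $\mathsf{ACM}\mathbb{Q}$, and its weighted distance is not computable in the $\mathsf{ACM}\mathbb{Q}$ either. Consequently, the weighted region shortest path problem cannot be solved exactly within the $\mathsf{ACM}\mathbb{Q}$: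 it is not true that every instance can be solved exactly, nor that every instance has a computable weighted distance. -/

import Mathlib

open Polynomial

noncomputable section

/-! ### Numbers computable in the algebraic computation model over `ℚ` -/

/-- The numbers obtained from `ℚ` by finitely many operations `+`, `-`, `×`, `÷` and `k`-th roots,
`k ≥ 2`. Intermediate values may be complex, and every complex `k`-th root may be taken. A real
number `x` is computable in the model when `ACMQ (x : ℂ)` holds. -/
inductive ACMQ : ℂ → Prop
  | rat (q : ℚ) : ACMQ (q : ℂ)
  | add {x y : ℂ} : ACMQ x → ACMQ y → ACMQ (x + y)
  | sub {x y : ℂ} : ACMQ x → ACMQ y → ACMQ (x - y)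
  | mul {x y : ℂ} : ACMQ x → ACMQ y → ACMQ (x * y)
  | div {x y : ℂ} : ACMQ x → ACMQ y → y ≠ 0 → ACMQ (x / y)
  | root {x y : ℂ} {k : ℕ} : 2 ≤ k → ACMQ x → y ^ k = x → ACMQ y

/-! ### The weighted region shortest path problem -/

/-- The Euclidean plane. -/
abbrev Plane : Type := EuclideanSpace ℝ (Fin 2)

/-- The point with rational coordinates `q`. -/
def ratPoint (q : ℚ × ℚ) : Plane := !₂[(q.1 : ℝ), (q.2 : ℝ)]

/-- The closed half-plane `a x + b y ≤ c`, where `h = (a, b, c)`. -/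
def halfPlane (h : ℚ × ℚ × ℚ) : Set Plane :=
  {p | (h.1 : ℝ) * p 0 + (h.2.1 : ℝ) * p 1 ≤ (h.2.2 : ℝ)}

/-- A finite intersection of closed half-planes. -/
def convexPiece (l : List (ℚ × ℚ × ℚ)) : Set Plane := {p | ∀ h ∈ l, p ∈ halfPlane h}

/-- A finite union of finite intersections of closed half-planes. -/
def polygonalSet (L : List (List (ℚ × ℚ × ℚ))) : Set Plane := {p | ∃ l ∈ L, p ∈ convexPiece l}

/-- An instance of the weighted region shortest path problem, with rational input data: a
subdivision of the plane into finitely many (possibly unbounded, not necessarily convex) closed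
polygonal regions, a positive weight for each region, a source and a target. -/
structure WeightedRegionInstance where
  /-- the number of regions -/
  n : ℕ
  /-- the half-planes describing each region -/
  pieces : Fin n → List (List (ℚ × ℚ × ℚ))
  /-- each region is the closure of its interior -/
  regular : ∀ i, closure (interior (polygonalSet (pieces i))) = polygonalSet (pieces i)
  /-- each region has a nonempty connected interior -/
  connected : ∀ i, IsConnected (interior (polygonalSet (pieces i)))
  /-- the regions cover the plane -/
  cover : ∀ p : Plane, ∃ i, p ∈ polygonalSet (pieces i)
  /-- distinct regions have disjoint interiors -/
  disjoint : ∀ i j, i ≠ j →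
    Disjoint (interior (polygonalSet (pieces i))) (interior (polygonalSet (pieces j)))
  /-- the weight of each region -/
  weight : Fin n → ℚ
  weight_pos : ∀ i, 0 < weight i
  /-- coordinates of the source -/
  source : ℚ × ℚ
  /-- coordinates of the target -/
  target : ℚ × ℚ

namespace WeightedRegionInstance

variable (I : WeightedRegionInstance)

/-- The `i`-th region. -/
def region (i : Fin I.n) : Set Plane := polygonalSet (I.pieces i)

/-- The source `s`. -/
def s : Plane := ratPoint I.source

/-- The target `t`. -/
def t : Plane := ratPoint I.target

/-- The weight at a point: the weight of the region that contains it; a point on a common boundary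
gets the smallest of the weights of the regions that contain it. -/
def localWeight (p : Plane) : ℝ := ⨅ i : {i : Fin I.n // p ∈ I.region i}, (I.weight i.1 : ℝ)

/-- The weighted length `∫₀¹ w(γ(r)) ‖γ'(r)‖ dr` of a (Lipschitz) path, that is, the weighted sum
of the Euclidean lengths of its parts within the regions. -/
def weightedLength (γ : Path I.s I.t) : ℝ :=
  ∫ r in (0 : ℝ)..1, I.localWeight (γ.extend r) * ‖deriv γ.extend r‖

/-- The competing paths: all Lipschitz paths from `s` to `t`. Every rectifiable curve has
a Lipschitz parametrization. -/
def IsAdmissible (γ : Path I.s I.t) : Prop := ∃ K : NNReal, LipschitzWith K γ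

/-- A shortest path from `s` to `t` in the weighted metric. -/
def IsShortestPath (γ : Path I.s I.t) : Prop :=
  I.IsAdmissible γ ∧ ∀ γ' : Path I.s I.t, I.IsAdmissible γ' →
    I.weightedLength γ ≤ I.weightedLength γ'

/-- The weighted distance from `s` to `t`. -/
def weightedDist : ℝ := ⨅ γ : {γ : Path I.s I.t // I.IsAdmissible γ}, I.weightedLength γ.1

end WeightedRegionInstance

/-- `γ` runs through the points `v 0, v 1, …, v m` in this order, along straight line segments. -/
def IsPolygonalChain {a b : Plane} (γ : Path a b) {m : ℕ} (v : Fin (m + 1) → Plane) : Prop :=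
  ∃ τ : Fin (m + 1) → ℝ, Monotone τ ∧ τ 0 = 0 ∧ τ (Fin.last m) = 1 ∧
    ∀ i : Fin m, ∀ r ∈ Set.Icc (0 : ℝ) 1,
      γ.extend (AffineMap.lineMap (τ i.castSucc) (τ i.succ) r) =
        AffineMap.lineMap (v i.castSucc) (v i.succ) r

/-- The instance can be solved exactly within the model: some shortest path is a polygonal chain
all of whose vertices have coordinates that are computable in the model. -/
def WeightedRegionInstance.IsExactlySolvable (I : WeightedRegionInstance) : Prop :=
  ∃ (γ : Path I.s I.t) (m : ℕ) (v : Fin (m + 1) → Plane),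
    I.IsShortestPath γ ∧ IsPolygonalChain γ v ∧ ∀ i j, ACMQ ((v i j : ℝ) : ℂ)

/-! ### The instance with three strips -/

/-- The half-planes describing `x ≤ 1`, `1 ≤ x ≤ 3` and `x ≥ 3`. -/
def stripPieces : Fin 3 → List (List (ℚ × ℚ × ℚ)) :=
  ![[[(1, 0, 1)]], [[(-1, 0, -1), (1, 0, 3)]], [[(-1, 0, -3)]]]

/-- The ranges of the `x`-coordinate in the three strips. -/
def stripRange : Fin 3 → Set ℝ := ![Set.Iic 1, Set.Icc 1 3, Set.Ici 3]

theorem polygonalSet_stripPieces (i : Fin 3) :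
    polygonalSet (stripPieces i) = EuclideanSpace.proj (𝕜 := ℝ) (0 : Fin 2) ⁻¹' stripRange i := by
  ext p
  fin_cases i <;>
    simp only [polygonalSet, convexPiece, halfPlane, stripPieces, stripRange, Fin.zero_eta,
      Fin.mk_one, Fin.reduceFinMk, Matrix.cons_val, Set.mem_ofPred_eq,
      List.mem_cons, List.not_mem_nil, or_false, exists_eq_left, forall_eq_or_imp, forall_eq,
      Set.mem_preimage] <;>
    simp

theorem isOpenMap_proj_zero :
    IsOpenMap (EuclideanSpace.proj (𝕜 := ℝ) (0 : Fin 2) : Plane →L[ℝ] ℝ) :=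
  ContinuousLinearMap.isOpenMap _ fun x => ⟨!₂[x, 0], by simp⟩

theorem interior_stripPieces (i : Fin 3) :
    interior (polygonalSet (stripPieces i)) =
      EuclideanSpace.proj (𝕜 := ℝ) (0 : Fin 2) ⁻¹'
        (![Set.Iio 1, Set.Ioo 1 3, Set.Ioi 3] : Fin 3 → Set ℝ) i := by
  rw [polygonalSet_stripPieces, ← isOpenMap_proj_zero.preimage_interior_eq_interior_preimage
    (ContinuousLinearMap.continuous _)]
  fin_cases i <;> simp [stripRange]

/-- The instance with `s = (0, 0)`, `t = (6, 2)` and regions `x ≤ 1`, `1 ≤ x ≤ 3`, `x ≥ 3` of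
weights `1`, `2`, `3`. -/
def stripInstance : WeightedRegionInstance where
  n := 3
  pieces := stripPieces
  regular i := by
    rw [interior_stripPieces, polygonalSet_stripPieces,
      ← isOpenMap_proj_zero.preimage_closure_eq_closure_preimage
        (ContinuousLinearMap.continuous _)]
    fin_cases i <;> simp [stripRange]
  connected i := by
    rw [interior_stripPieces]
    refine ⟨?_, ?_⟩
    · refine Set.Nonempty.preimage ?_ fun x => ⟨!₂[x, 0], by simp⟩
      fin_cases i <;> simp
    · refine Convex.isPreconnected (Convex.linear_preimage (𝕜 := ℝ) ?_
        (EuclideanSpace.proj (𝕜 := ℝ) (0 : Fin 2) : Plane →L[ℝ] ℝ).toLinearMap)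
      fin_cases i
      · exact convex_Iio 1
      · exact convex_Ioo 1 3
      · exact convex_Ioi 3
  cover p := by
    simp only [polygonalSet_stripPieces, Fin.exists_fin_succ, stripRange]
    simp
    grind
  disjoint i j hij := by
    rw [interior_stripPieces, interior_stripPieces]
    refine Disjoint.preimage _ ?_
    rw [Set.disjoint_left]
    fin_cases i <;> fin_cases j <;> simp at hij ⊢ <;> grind
  weight := ![1, 2, 3]
  weight_pos i := by fin_cases i <;> simp
  source := (0, 0)
  target := (6, 2)

/-- The function `φ`; with `X` the sine of the angle of incidence in the first region, the equation
`φ X = 2` says that a path obeying Snell's law from `(0, 0)` ends in `(6, 2)`. -/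
def snellPhi (X : ℝ) : ℝ :=
  X / √(1 - X ^ 2) + 2 * ((X / 2) / √(1 - (X / 2) ^ 2)) + 3 * ((X / 3) / √(1 - (X / 3) ^ 2))

/-- The point where the path with sine `X` leaves the first region. -/
def firstBend (X : ℝ) : Plane := !₂[1, X / √(1 - X ^ 2)]

/-- The point where the path with sine `X` leaves the second region. -/
def secondBend (X : ℝ) : Plane :=
  !₂[3, X / √(1 - X ^ 2) + 2 * ((X / 2) / √(1 - (X / 2) ^ 2))]

/-- The polynomial `p₁₂`. -/
def p12 : ℚ[X] :=
  419904 - 3545856 * X + 12394944 * X ^ 2 - 24006816 * X ^ 3 + 28904608 * X ^ 4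
    - 22882588 * X ^ 5 + 12204109 * X ^ 6 - 4396586 * X ^ 7 + 1060979 * X ^ 8
    - 168272 * X ^ 9 + 16843 * X ^ 10 - 970 * X ^ 11 + 25 * X ^ 12

end

/-! The geometric half is a calibration. In a strip of weight w the vector (√(w² − α²), α) has norm
w. Its vertical component is the same in all strips, so these vectors are the gradient of one
continuous function, `snellPotential α x + α y`. By Cauchy–Schwarz the weighted speed of a Lipschitz
curve is at least the derivative of this potential along it, so every path from s to t costs at
least `snellLength α` (`weighted_speed_calibration`). Equality forces the velocity to be almost
everywhere a nonnegative multiple of the gradient, hence the curve follows the graph of `snellHeight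
α`, which ends at t exactly when φ(α) = 2. Existence, uniqueness of the image and the value of the
distance all follow. The graph has a kink at the first bend, so this bend is a vertex of every
polygonal shortest path.

The arithmetic half starts by squaring away the roots in φ(α) = 2, which gives p₁₂(α²) = 0. Modulo
31 the polynomial has a simple root and Frobenius permutes the other roots in an 11-cycle; modulo 17
it is a quadratic times two quintics, so the fifth power of Frobenius is a transposition, and
Frobenius has no fixed point. Such elements generate S₁₂ (`Subgroup.eq_top_of_swap_mem`), so α² is
not expressible by radicals, and neither are α and the two bends, since α² is a rational function of
each.

For the distance D, the terms of the Snell equation lie in ℚ(α²), and so does D². A point stabiliser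
is maximal in S₁₂, so D² is either rational or generates ℚ(α²) (`fixed_or_mem_adjoin`). It is not
rational: flipping the sign of the third square root yields another real root β² of p₁₂, and the
corresponding conjugate of D² is strictly smaller (`conjugate_length_ne`). Hence a radical D would
make α² radical. -/

/-! ### The Snell equation: uniqueness and location of its solution. -/

theorem strictMonoOn_div_sqrt_one_sub_sq :
    StrictMonoOn (fun X : ℝ => X / √(1 - X ^ 2)) (Set.Ico 0 1) := by
  intro x hx y hy hxy
  have hx2 : 0 < 1 - x ^ 2 := by nlinarith [hx.1, hx.2]
  have hy2 : 0 < 1 - y ^ 2 := by nlinarith [hy.1, hy.2]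
  have h : √(1 - y ^ 2) < √(1 - x ^ 2) :=
    Real.sqrt_lt_sqrt hy2.le (by nlinarith [hx.1])
  have hy3 := Real.sqrt_pos.2 hy2
  calc x / √(1 - x ^ 2) ≤ x / √(1 - y ^ 2) := div_le_div_of_nonneg_left hx.1 hy3 h.le
    _ < y / √(1 - y ^ 2) := div_lt_div_of_pos_right hxy hy3

theorem snellPhi_strictMonoOn : StrictMonoOn snellPhi (Set.Ico 0 1) := by
  intro x hx y hy hxy
  have key : ∀ w : ℝ, 1 ≤ w → (x / w) / √(1 - (x / w) ^ 2) < (y / w) / √(1 - (y / w) ^ 2) := by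
    intro w hw
    have hw0 : 0 < w := by linarith
    refine strictMonoOn_div_sqrt_one_sub_sq ⟨div_nonneg hx.1 hw0.le, ?_⟩
      ⟨div_nonneg hy.1 hw0.le, ?_⟩ (div_lt_div_of_pos_right hxy hw0)
    · rw [div_lt_one hw0]; linarith [hx.2]
    · rw [div_lt_one hw0]; linarith [hy.2]
  have h1 := key 1 le_rfl
  simp only [div_one] at h1
  have h2 := key 2 (by norm_num)
  have h3 := key 3 (by norm_num)
  unfold snellPhi
  linarith

theorem one_sub_div_sq_pos {x w : ℝ} (hx : 0 ≤ x) (hx1 : x < 1) (hw : 1 ≤ w) :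
    0 < 1 - (x / w) ^ 2 := by
  have h1 : x / w < 1 := by rw [div_lt_one (by linarith)]; linarith
  have h2 : 0 ≤ x / w := by positivity
  nlinarith

theorem snellPhi_continuousOn : ContinuousOn snellPhi (Set.Ico 0 1) := by
  unfold snellPhi
  intro x hx
  have h1 : √(1 - x ^ 2) ≠ 0 := by
    simpa using (Real.sqrt_pos.2 (one_sub_div_sq_pos hx.1 hx.2 le_rfl)).ne'
  have h2 : √(1 - (x / 2) ^ 2) ≠ 0 :=
    (Real.sqrt_pos.2 (one_sub_div_sq_pos hx.1 hx.2 (by norm_num))).ne'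
  have h3 : √(1 - (x / 3) ^ 2) ≠ 0 :=
    (Real.sqrt_pos.2 (one_sub_div_sq_pos hx.1 hx.2 (by norm_num))).ne'
  refine ContinuousAt.continuousWithinAt ?_
  fun_prop (disch := assumption)

theorem snellPhi_lower : snellPhi 0.60206 < 2 := by
  unfold snellPhi
  -- The square roots are rounded down to five decimals, so that the quotients are overestimated;
  -- the upper bound below rounds them up instead.
  have h1 : (0.79845 : ℝ) ≤ √(1 - 0.60206 ^ 2) := Real.le_sqrt_of_sq_le (by norm_num)
  have h2 : (0.95361 : ℝ) ≤ √(1 - (0.60206 / 2) ^ 2) := Real.le_sqrt_of_sq_le (by norm_num)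
  have h3 : (0.97965 : ℝ) ≤ √(1 - (0.60206 / 3) ^ 2) := Real.le_sqrt_of_sq_le (by norm_num)
  have k1 : (0.60206 : ℝ) / √(1 - 0.60206 ^ 2) ≤ 0.60206 / 0.79845 := by gcongr
  have k2 : (0.60206 / 2 : ℝ) / √(1 - (0.60206 / 2) ^ 2) ≤ 0.60206 / 2 / 0.95361 := by gcongr
  have k3 : (0.60206 / 3 : ℝ) / √(1 - (0.60206 / 3) ^ 2) ≤ 0.60206 / 3 / 0.97965 := by gcongr
  norm_num at k1 k2 k3 ⊢
  linarith

theorem snellPhi_upper : 2 < snellPhi 0.60208 := by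
  unfold snellPhi
  have h1 : √(1 - 0.60208 ^ 2) ≤ (0.79844 : ℝ) := Real.sqrt_le_iff.2 (by norm_num)
  have h2 : √(1 - (0.60208 / 2) ^ 2) ≤ (0.95362 : ℝ) := Real.sqrt_le_iff.2 (by norm_num)
  have h3 : √(1 - (0.60208 / 3) ^ 2) ≤ (0.97966 : ℝ) := Real.sqrt_le_iff.2 (by norm_num)
  have p1 : (0 : ℝ) < √(1 - 0.60208 ^ 2) := Real.sqrt_pos.2 (by norm_num)
  have p2 : (0 : ℝ) < √(1 - (0.60208 / 2) ^ 2) := Real.sqrt_pos.2 (by norm_num)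
  have p3 : (0 : ℝ) < √(1 - (0.60208 / 3) ^ 2) := Real.sqrt_pos.2 (by norm_num)
  have k1 : 0.60208 / 0.79844 ≤ (0.60208 : ℝ) / √(1 - 0.60208 ^ 2) := by gcongr
  have k2 : 0.60208 / 2 / 0.95362 ≤ (0.60208 / 2 : ℝ) / √(1 - (0.60208 / 2) ^ 2) := by gcongr
  have k3 : 0.60208 / 3 / 0.97966 ≤ (0.60208 / 3 : ℝ) / √(1 - (0.60208 / 3) ^ 2) := by gcongr
  norm_num at k1 k2 k3 ⊢
  linarith

theorem exists_snell_root :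
    ∃ α : ℝ, (0.60206 < α ∧ α < 0.60208) ∧
      ∀ x : ℝ, 0 ≤ x → x < 1 → (snellPhi x = 2 ↔ x = α) := by
  have hc : ContinuousOn snellPhi (Set.Icc 0.60206 0.60208) :=
    snellPhi_continuousOn.mono fun x hx => ⟨by linarith [hx.1], by linarith [hx.2]⟩
  obtain ⟨α, hα, h⟩ := intermediate_value_Ioo (by norm_num) hc ⟨snellPhi_lower, snellPhi_upper⟩
  refine ⟨α, hα, fun x hx0 hx1 => ⟨fun hx => ?_, fun hx => hx ▸ h⟩⟩
  exact snellPhi_strictMonoOn.injOn ⟨hx0, hx1⟩ ⟨by linarith [hα.1], by linarith [hα.2]⟩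
    (hx.trans h.symm)

/-! ### Elimination of the square roots. -/

/-- The rationalised Snell equation: `x`, `y`, `z` are square roots of `a / (1 - a)`,
`4 a / (4 - a)`, `9 a / (9 - a)` with sum `2`. -/
structure SnellTriple {F : Type*} [Field F] (a x y z : F) : Prop where
  hx : x ^ 2 * (1 - a) = a
  hy : y ^ 2 * (4 - a) = 4 * a
  hz : z ^ 2 * (9 - a) = 9 * a
  sum_eq : x + y + z = 2

theorem aeval_p12_of_snell {F : Type*} [Field F] [CharZero F] {a x y z : F}
    (h1 : 1 - a ≠ 0) (h4 : 4 - a ≠ 0) (h9 : 9 - a ≠ 0) (h : SnellTriple a x y z) :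
    aeval a p12 = 0 := by
  have hx : x ^ 2 = a / (1 - a) := by rw [eq_div_iff h1, h.hx]
  have hy : y ^ 2 = 4 * a / (4 - a) := by rw [eq_div_iff h4, h.hy]
  have hz : z ^ 2 = 9 * a / (9 - a) := by rw [eq_div_iff h9, h.hz]
  -- Put C = 4 + z² − x² − y². Squaring x + y = 2 − z gives 2xy = C − 4z. Squaring again leaves z as
  -- the only odd power, in the term 8Cz, and a third squaring leaves only x², y², z², which are
  -- rational in a.
  have e1 : 2 * x * y = (4 + z ^ 2 - x ^ 2 - y ^ 2) - 4 * z := by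
    have : x + y = 2 - z := by linear_combination h.sum_eq
    linear_combination (x + y + 2 - z) * this
  have e2 : (4 + z ^ 2 - x ^ 2 - y ^ 2) ^ 2 + 16 * z ^ 2 - 4 * x ^ 2 * y ^ 2 =
      8 * (4 + z ^ 2 - x ^ 2 - y ^ 2) * z := by
    linear_combination (-(2 * x * y) - ((4 + z ^ 2 - x ^ 2 - y ^ 2) - 4 * z)) * e1
  have e3 : ((4 + z ^ 2 - x ^ 2 - y ^ 2) ^ 2 + 16 * z ^ 2 - 4 * x ^ 2 * y ^ 2) ^ 2 =
      64 * (4 + z ^ 2 - x ^ 2 - y ^ 2) ^ 2 * z ^ 2 := by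
    rw [e2]; ring
  rw [hx, hy, hz] at e3
  field_simp at e3
  simp only [p12, map_add, map_sub, map_mul, map_pow, aeval_X, map_ofNat]
  -- With denominators cleared, the relation is 1024 times p₁₂(a) = 0.
  linear_combination e3 / 1024

/-! ### Piecewise linear functions of the abscissa and their chain rule. -/

/-- The continuous piecewise linear function vanishing at `0` with slopes `c₁`, `c₂`, `c₃` on
`x ≤ 1`, `1 ≤ x ≤ 3`, `x ≥ 3`. -/
noncomputable def stripLinear (c₁ c₂ c₃ t : ℝ) : ℝ :=
  c₁ * t + (c₂ - c₁) * max (t - 1) 0 + (c₃ - c₂) * max (t - 3) 0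

/-- The value of a function that takes the values `c₁`, `c₂`, `c₃` on `t ≤ 1`, `1 < t ≤ 3`,
`3 < t`. -/
noncomputable def stripConst (c₁ c₂ c₃ t : ℝ) : ℝ :=
  if t ≤ 1 then c₁ else if t ≤ 3 then c₂ else c₃

theorem stripLinear_lipschitz (c₁ c₂ c₃ : ℝ) : ∃ K, LipschitzWith K (stripLinear c₁ c₂ c₃) := by
  refine ⟨Real.toNNReal (|c₁| + |c₂ - c₁| + |c₃ - c₂|), LipschitzWith.of_dist_le_mul fun x y => ?_⟩
  rw [Real.coe_toNNReal _ (by positivity), Real.dist_eq, Real.dist_eq]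
  have h1 : |max (x - 1) 0 - max (y - 1) 0| ≤ |x - y| := by
    simpa using abs_max_sub_max_le_abs (x - 1) (y - 1) 0
  have h3 : |max (x - 3) 0 - max (y - 3) 0| ≤ |x - y| := by
    simpa using abs_max_sub_max_le_abs (x - 3) (y - 3) 0
  calc |stripLinear c₁ c₂ c₃ x - stripLinear c₁ c₂ c₃ y|
      = |c₁ * (x - y) + (c₂ - c₁) * (max (x - 1) 0 - max (y - 1) 0)
          + (c₃ - c₂) * (max (x - 3) 0 - max (y - 3) 0)| := by
        unfold stripLinear; congr 1; ring
    _ ≤ |c₁ * (x - y)| + |(c₂ - c₁) * (max (x - 1) 0 - max (y - 1) 0)|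
          + |(c₃ - c₂) * (max (x - 3) 0 - max (y - 3) 0)| := abs_add_three _ _ _
    _ ≤ |c₁| * |x - y| + |c₂ - c₁| * |x - y| + |c₃ - c₂| * |x - y| := by
        simp only [abs_mul]
        gcongr
    _ = _ := by ring

theorem stripLinear_neg (c₁ c₂ c₃ t : ℝ) :
    stripLinear (-c₁) (-c₂) (-c₃) t = -stripLinear c₁ c₂ c₃ t := by
  unfold stripLinear; ring

theorem stripConst_neg (c₁ c₂ c₃ t : ℝ) :
    stripConst (-c₁) (-c₂) (-c₃) t = -stripConst c₁ c₂ c₃ t := by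
  unfold stripConst; split_ifs <;> rfl

/-- Increasing slopes make the function convex, and `stripConst` picks the left slope at a
breakpoint, which is a subgradient. -/
theorem stripLinear_support {c₁ c₂ c₃ : ℝ} (h12 : c₁ ≤ c₂) (h23 : c₂ ≤ c₃) (t u : ℝ) :
    stripConst c₁ c₂ c₃ t * (u - t) + stripLinear c₁ c₂ c₃ t ≤ stripLinear c₁ c₂ c₃ u := by
  unfold stripConst stripLinear
  have a1 := le_max_left (u - 1) 0
  have a2 := le_max_right (u - 1) 0
  have a3 := le_max_left (u - 3) 0
  have a4 := le_max_right (u - 3) 0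
  split_ifs with h1 h3
  · rw [max_eq_right (by linarith : t - 1 ≤ 0), max_eq_right (by linarith : t - 3 ≤ 0)]
    nlinarith
  · rw [max_eq_left (by linarith : 0 ≤ t - 1), max_eq_right (by linarith : t - 3 ≤ 0)]
    nlinarith
  · rw [max_eq_left (by linarith : 0 ≤ t - 1), max_eq_left (by linarith : 0 ≤ t - 3)]
    nlinarith

/-- A chain rule that survives the breakpoints, where the outer function need not be differentiable.
The supporting line minus the function, composed with x, has a maximum at r; its derivative vanishes
there as soon as the composition is differentiable. -/
theorem hasDerivAt_stripLinear_comp {c₁ c₂ c₃ : ℝ} (h12 : c₁ ≤ c₂) (h23 : c₂ ≤ c₃) {x : ℝ → ℝ}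
    {x' r : ℝ} (hx : HasDerivAt x x' r)
    (hd : DifferentiableAt ℝ (fun s => stripLinear c₁ c₂ c₃ (x s)) r) :
    HasDerivAt (fun s => stripLinear c₁ c₂ c₃ (x s)) (stripConst c₁ c₂ c₃ (x r) * x') r := by
  have h1 : HasDerivAt (fun s => stripConst c₁ c₂ c₃ (x r) * (x s - x r)
      + stripLinear c₁ c₂ c₃ (x r) - stripLinear c₁ c₂ c₃ (x s))
      (stripConst c₁ c₂ c₃ (x r) * x' - deriv (fun s => stripLinear c₁ c₂ c₃ (x s)) r) r :=
    (((hx.sub_const _).const_mul _).add_const _).sub hd.hasDerivAt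
  have h2 := IsLocalMax.hasDerivAt_eq_zero (Filter.Eventually.of_forall fun s => ?_) h1
  · rw [sub_eq_zero.1 h2]
    exact hd.hasDerivAt
  · have := stripLinear_support h12 h23 (x r) (x s)
    simp only [sub_self, mul_zero, zero_add]
    linarith

theorem hasDerivAt_stripLinear_comp' {c₁ c₂ c₃ : ℝ} (h12 : c₂ ≤ c₁) (h23 : c₃ ≤ c₂) {x : ℝ → ℝ}
    {x' r : ℝ} (hx : HasDerivAt x x' r)
    (hd : DifferentiableAt ℝ (fun s => stripLinear c₁ c₂ c₃ (x s)) r) :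
    HasDerivAt (fun s => stripLinear c₁ c₂ c₃ (x s)) (stripConst c₁ c₂ c₃ (x r) * x') r := by
  have h := hasDerivAt_stripLinear_comp (neg_le_neg h12) (neg_le_neg h23) hx
    (by simp only [stripLinear_neg]; exact hd.neg)
  simp only [stripLinear_neg, stripConst_neg] at h
  convert! h.neg using 1
  · ext s; simp
  · ring

/-- On the lines x = 1 and x = 3 the smaller weight is that of the strip on the left, which agrees
with the conventions of `stripConst`. -/
theorem stripInstance_localWeight (p : Plane) :
    stripInstance.localWeight p = stripConst 1 2 3 (p 0) := by
  let W : Fin 3 → ℚ := ![1, 2, 3]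
  have hdef : stripInstance.localWeight p =
    ⨅ i : {i : Fin 3 // p ∈ polygonalSet (stripPieces i)}, (W i.1 : ℝ) := rfl
  have hreg : ∀ i, p ∈ polygonalSet (stripPieces i) ↔ p 0 ∈ stripRange i := fun i => by
    rw [polygonalSet_stripPieces]; rfl
  have key : ∀ j : Fin 3, p 0 ∈ stripRange j → (∀ i, p 0 ∈ stripRange i → W j ≤ W i) →
      stripInstance.localWeight p = W j := fun j hj hmin => by
    have : Nonempty {i : Fin 3 // p ∈ polygonalSet (stripPieces i)} := ⟨⟨j, (hreg j).2 hj⟩⟩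
    rw [hdef]
    refine le_antisymm ?_ (le_ciInf fun i => by exact_mod_cast hmin i.1 ((hreg _).1 i.2))
    exact ciInf_le (f := fun i : {i : Fin 3 // p ∈ polygonalSet (stripPieces i)} =>
      (W i.1 : ℝ)) (Set.finite_range _).bddBelow ⟨j, (hreg j).2 hj⟩
  unfold stripConst
  split_ifs with ha hb
  · rw [key 0 ha]
    · simp [W]
    · intro i _; fin_cases i <;> simp [W]
  · rw [key 1 ⟨by linarith, hb⟩]
    · simp [W]
    · intro i hi
      fin_cases i
      · exact absurd hi ha
      · exact le_rfl
      · simp [W]; norm_num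
  · rw [key 2 (le_of_lt (not_le.1 hb))]
    · simp [W]
    · intro i hi
      fin_cases i
      · exact absurd hi ha
      · exact absurd hi.2 hb
      · exact le_rfl

theorem HasDerivAt.plane_apply {e : ℝ → Plane} {e' : Plane} {r : ℝ} (h : HasDerivAt e e' r)
    (i : Fin 2) : HasDerivAt (fun s => e s i) (e' i) r := by
  have := ((EuclideanSpace.proj (𝕜 := ℝ) i : Plane →L[ℝ] ℝ).hasFDerivAt (x := e r)).comp_hasDerivAt
    r h
  exact this

theorem LipschitzWith.plane_apply {e : ℝ → Plane} {K : NNReal} (h : LipschitzWith K e)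
    (i : Fin 2) : LipschitzWith K (fun s => e s i) := by
  refine LipschitzWith.of_dist_le_mul fun s r => (?_ : _ ≤ dist (e s) (e r)).trans (h.dist_le_mul s r)
  rw [dist_eq_norm, dist_eq_norm]
  exact PiLp.norm_apply_le (e s - e r) i

theorem LipschitzWith.path_extend {X : Type*} [PseudoMetricSpace X] {a b : X} {γ : Path a b}
    {K : NNReal} (h : LipschitzWith K γ) : LipschitzWith K γ.extend := by
  have := h.comp (LipschitzWith.projIcc (zero_le_one' ℝ))
  rwa [mul_one] at this

/-! ### The calibration argument. -/

/-- Cauchy–Schwarz for the calibration by `(g, α)`, a vector of norm `w`, and its equality case. -/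
theorem calibration_le {g α w u v : ℝ} (hw : 0 ≤ w) (h : g ^ 2 + α ^ 2 = w ^ 2) :
    g * u + α * v ≤ w * √(u ^ 2 + v ^ 2) := by
  refine abs_le_of_sq_le_sq' ?_ (by positivity) |>.2
  rw [mul_pow, Real.sq_sqrt (by positivity), ← h]
  -- Lagrange's identity: (g² + α²)(u² + v²) − (gu + αv)² = (gv − αu)². The equality case below uses
  -- it again.
  nlinarith [sq_nonneg (g * v - α * u)]

theorem calibration_eq_iff {g α w u v : ℝ} (hg : 0 < g) (hw : 0 ≤ w)
    (h : g ^ 2 + α ^ 2 = w ^ 2) :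
    g * u + α * v = w * √(u ^ 2 + v ^ 2) ↔ 0 ≤ u ∧ v = α / g * u := by
  constructor
  · intro he
    have h0 : 0 ≤ g * u + α * v := he ▸ by positivity
    have h1 : (g * u + α * v) ^ 2 = (g ^ 2 + α ^ 2) * (u ^ 2 + v ^ 2) := by
      rw [he, mul_pow, Real.sq_sqrt (by positivity), h]
    have h2 : g * v - α * u = 0 := by
      have : (g * v - α * u) ^ 2 = 0 := by linear_combination -h1
      simpa using this
    have h3 : v = α / g * u := by field_simp; linarith
    refine ⟨?_, h3⟩
    by_contra! hu
    have : g * u + α * v = (g ^ 2 + α ^ 2) / g * u := by rw [h3]; field_simp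
    have : (g ^ 2 + α ^ 2) / g * u < 0 := mul_neg_of_pos_of_neg (by positivity) hu
    linarith
  · rintro ⟨hu, hv⟩
    have h1 : u ^ 2 + v ^ 2 = (w / g * u) ^ 2 := by
      rw [hv]; field_simp; rw [h]
    rw [h1, Real.sqrt_sq (by positivity), hv]
    field_simp
    linear_combination u * h

/-- The horizontal part of the calibrating potential `(x, y) ↦ snellPotential α x + α y`. -/
noncomputable def snellPotential (α : ℝ) : ℝ → ℝ :=
  stripLinear √(1 - α ^ 2) √(4 - α ^ 2) √(9 - α ^ 2)

/-- The height of the path with sine `α` as a function of the abscissa. -/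
noncomputable def snellHeight (α : ℝ) : ℝ → ℝ :=
  stripLinear (α / √(1 - α ^ 2)) (α / √(4 - α ^ 2)) (α / √(9 - α ^ 2))

/-- The weighted length of the path with sine `α` from `(0, 0)` to `(6, 2)`. -/
noncomputable def snellLength (α : ℝ) : ℝ :=
  √(1 - α ^ 2) + 2 * √(4 - α ^ 2) + 3 * √(9 - α ^ 2) + 2 * α

theorem half_term {α : ℝ} : 2 * ((α / 2) / √(1 - (α / 2) ^ 2)) = 2 * (α / √(4 - α ^ 2)) := by
  have h : √(4 - α ^ 2) = 2 * √(1 - (α / 2) ^ 2) := by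
    rw [show 4 - α ^ 2 = 2 ^ 2 * (1 - (α / 2) ^ 2) by ring, Real.sqrt_mul (by norm_num),
      Real.sqrt_sq (by norm_num)]
  rw [h, div_div]

theorem third_term {α : ℝ} : 3 * ((α / 3) / √(1 - (α / 3) ^ 2)) = 3 * (α / √(9 - α ^ 2)) := by
  have h : √(9 - α ^ 2) = 3 * √(1 - (α / 3) ^ 2) := by
    rw [show 9 - α ^ 2 = 3 ^ 2 * (1 - (α / 3) ^ 2) by ring, Real.sqrt_mul (by norm_num),
      Real.sqrt_sq (by norm_num)]
  rw [h, div_div]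

theorem snellPhi_eq (α : ℝ) :
    snellPhi α = α / √(1 - α ^ 2) + 2 * (α / √(4 - α ^ 2)) + 3 * (α / √(9 - α ^ 2)) := by
  rw [snellPhi, half_term, third_term]

theorem snellHeight_zero (α : ℝ) : snellHeight α 0 = 0 := by
  norm_num [snellHeight, stripLinear]

theorem snellHeight_one (α : ℝ) : snellHeight α 1 = firstBend α 1 := by
  norm_num [snellHeight, stripLinear, firstBend]

theorem snellHeight_three (α : ℝ) : snellHeight α 3 = secondBend α 1 := by
  simp only [secondBend, half_term]
  norm_num [snellHeight, stripLinear]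
  ring

theorem snellHeight_six (α : ℝ) : snellHeight α 6 = snellPhi α := by
  rw [snellPhi_eq]
  norm_num [snellHeight, stripLinear]
  ring

theorem snellPotential_zero (α : ℝ) : snellPotential α 0 = 0 := by
  norm_num [snellPotential, stripLinear]

theorem snellPotential_six (α : ℝ) : snellPotential α 6 + 2 * α = snellLength α := by
  norm_num [snellPotential, stripLinear, snellLength]
  ring

theorem stripInstance_s : stripInstance.s = !₂[0, 0] := by
  simp [WeightedRegionInstance.s, stripInstance, ratPoint]

theorem stripInstance_t : stripInstance.t = !₂[6, 2] := by
  simp [WeightedRegionInstance.t, stripInstance, ratPoint]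

section

variable {α : ℝ}

theorem stripConst_div_sqrt (t : ℝ) :
    stripConst (α / √(1 - α ^ 2)) (α / √(4 - α ^ 2)) (α / √(9 - α ^ 2)) t =
      α / stripConst √(1 - α ^ 2) √(4 - α ^ 2) √(9 - α ^ 2) t := by
  unfold stripConst; split_ifs <;> rfl

theorem stripConst_sqrt_pos (h0 : 0 < α) (h1 : α < 1) (t : ℝ) :
    0 < stripConst √(1 - α ^ 2) √(4 - α ^ 2) √(9 - α ^ 2) t := by
  unfold stripConst
  split_ifs <;> exact Real.sqrt_pos.2 (by nlinarith)

theorem stripConst_sqrt_sq (h0 : 0 < α) (h1 : α < 1) (t : ℝ) :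
    stripConst √(1 - α ^ 2) √(4 - α ^ 2) √(9 - α ^ 2) t ^ 2 + α ^ 2 = stripConst 1 2 3 t ^ 2 := by
  unfold stripConst
  split_ifs <;> rw [Real.sq_sqrt (by nlinarith)] <;> norm_num

theorem stripConst_weight_nonneg (t : ℝ) : 0 ≤ stripConst 1 2 3 t := by
  unfold stripConst; split_ifs <;> norm_num

theorem stripConst_weight_le (t : ℝ) : stripConst 1 2 3 t ≤ 3 := by
  unfold stripConst; split_ifs <;> norm_num

theorem measurable_stripConst (c₁ c₂ c₃ : ℝ) : Measurable (stripConst c₁ c₂ c₃) := by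
  unfold stripConst
  refine Measurable.ite (measurableSet_le measurable_id measurable_const) measurable_const ?_
  exact Measurable.ite (measurableSet_le measurable_id measurable_const) measurable_const
    measurable_const

theorem hasDerivAt_snellPotential_comp {x : ℝ → ℝ} {x' r : ℝ} (hx : HasDerivAt x x' r)
    (hd : DifferentiableAt ℝ (fun s => snellPotential α (x s)) r) :
    HasDerivAt (fun s => snellPotential α (x s))
      (stripConst √(1 - α ^ 2) √(4 - α ^ 2) √(9 - α ^ 2) (x r) * x') r :=
  hasDerivAt_stripLinear_comp (Real.sqrt_le_sqrt (by linarith)) (Real.sqrt_le_sqrt (by linarith))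
    hx hd

theorem hasDerivAt_snellHeight_comp (h0 : 0 < α) (h1 : α < 1) {x : ℝ → ℝ} {x' r : ℝ}
    (hx : HasDerivAt x x' r) (hd : DifferentiableAt ℝ (fun s => snellHeight α (x s)) r) :
    HasDerivAt (fun s => snellHeight α (x s))
      (α / stripConst √(1 - α ^ 2) √(4 - α ^ 2) √(9 - α ^ 2) (x r) * x') r := by
  have p1 : 0 < √(1 - α ^ 2) := Real.sqrt_pos.2 (by nlinarith)
  have l1 : √(1 - α ^ 2) ≤ √(4 - α ^ 2) := Real.sqrt_le_sqrt (by linarith)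
  have l2 : √(4 - α ^ 2) ≤ √(9 - α ^ 2) := Real.sqrt_le_sqrt (by linarith)
  rw [← stripConst_div_sqrt]
  exact hasDerivAt_stripLinear_comp' (div_le_div_of_nonneg_left h0.le p1 l1)
    (div_le_div_of_nonneg_left h0.le (by linarith) l2) hx hd

theorem norm_plane_deriv {e : ℝ → Plane} {e' : Plane} {r : ℝ} (h : HasDerivAt e e' r) :
    ‖deriv e r‖ = √(deriv (fun s => e s 0) r ^ 2 + deriv (fun s => e s 1) r ^ 2) := by
  rw [h.deriv, (h.plane_apply 0).deriv, (h.plane_apply 1).deriv, EuclideanSpace.norm_eq]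
  simp

open MeasureTheory Set

theorem LipschitzWith.integral_deriv {f : ℝ → ℝ} {K : NNReal} (hf : LipschitzWith K f) (a b : ℝ) :
    ∫ r in a..b, deriv f r = f b - f a :=
  (hf.lipschitzOnWith.absolutelyContinuousOnInterval).integral_deriv_eq_sub

theorem LipschitzWith.intervalIntegrable_deriv {f : ℝ → ℝ} {K : NNReal} (hf : LipschitzWith K f)
    (a b : ℝ) : IntervalIntegrable (deriv f) volume a b :=
  (hf.lipschitzOnWith.absolutelyContinuousOnInterval).intervalIntegrable_deriv

theorem intervalIntegrable_weighted_speed {e : ℝ → Plane} {K : NNReal} (he : LipschitzWith K e)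
    (a b : ℝ) :
    IntervalIntegrable (fun r => stripConst 1 2 3 (e r 0) * ‖deriv e r‖) volume a b := by
  have hm : Measurable (fun r => stripConst 1 2 3 (e r 0) * ‖deriv e r‖) :=
    ((measurable_stripConst 1 2 3).comp (he.plane_apply 0).continuous.measurable).mul
      (measurable_deriv e).norm
  refine IntervalIntegrable.mono_fun (g := fun r => stripConst 1 2 3 (e r 0) * ‖deriv e r‖)
    (f := fun _ => 3 * (K : ℝ)) intervalIntegrable_const hm.aestronglyMeasurable ?_
  refine Filter.Eventually.of_forall fun r => ?_
  beta_reduce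
  rw [Real.norm_of_nonneg (mul_nonneg (stripConst_weight_nonneg _) (norm_nonneg _)),
    Real.norm_of_nonneg (by positivity)]
  exact mul_le_mul (stripConst_weight_le _) (norm_deriv_le_of_lipschitz he) (norm_nonneg _)
    (by norm_num)

/-- The calibration inequality for the weighted length of Lipschitz curves, with its equality
case. -/
theorem weighted_speed_calibration (h0 : 0 < α) (h1 : α < 1) {e : ℝ → Plane} {K : NNReal}
    (he : LipschitzWith K e) :
    (snellPotential α (e 1 0) + α * e 1 1) - (snellPotential α (e 0 0) + α * e 0 1) ≤
      ∫ r in (0 : ℝ)..1, stripConst 1 2 3 (e r 0) * ‖deriv e r‖ ∧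
    ((snellPotential α (e 1 0) + α * e 1 1) - (snellPotential α (e 0 0) + α * e 0 1) =
      ∫ r in (0 : ℝ)..1, stripConst 1 2 3 (e r 0) * ‖deriv e r‖ ↔
      ∀ᵐ r, r ∈ Ioc (0 : ℝ) 1 → 0 ≤ deriv (fun s => e s 0) r ∧
        HasDerivAt (fun s => e s 1 - snellHeight α (e s 0)) 0 r) := by
  obtain ⟨Kg, hg⟩ := stripLinear_lipschitz √(1 - α ^ 2) √(4 - α ^ 2) √(9 - α ^ 2)
  obtain ⟨Kh, hh⟩ := stripLinear_lipschitz (α / √(1 - α ^ 2)) (α / √(4 - α ^ 2)) (α / √(9 - α ^ 2))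
  have hg' := hg.comp (he.plane_apply 0)
  have hh' := hh.comp (he.plane_apply 0)
  have hαy : LipschitzWith (‖α‖₊ * K) (fun s => α * e s 1) :=
    LipschitzWith.of_dist_le_mul fun s r => by
      have := (he.plane_apply 1).dist_le_mul s r
      simp only [Real.dist_eq, ← mul_sub, abs_mul, NNReal.coe_mul, coe_nnnorm, Real.norm_eq_abs]
        at this ⊢
      rw [mul_assoc]
      gcongr
  have hF := hg'.add hαy
  set F : ℝ → ℝ := fun s => snellPotential α (e s 0) + α * e s 1 with hFdef
  have hF' : LipschitzWith (Kg * K + ‖α‖₊ * K) F := hF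
  rw [show (snellPotential α (e 1 0) + α * e 1 1) - (snellPotential α (e 0 0) + α * e 0 1)
    = ∫ r in (0 : ℝ)..1, deriv F r from (hF'.integral_deriv 0 1).symm]
  have hI1 := hF'.intervalIntegrable_deriv 0 1
  have hI2 := intervalIntegrable_weighted_speed he 0 1
  have hae : ∀ᵐ r, deriv F r ≤ stripConst 1 2 3 (e r 0) * ‖deriv e r‖ ∧
      (deriv F r = stripConst 1 2 3 (e r 0) * ‖deriv e r‖ ↔ 0 ≤ deriv (fun s => e s 0) r ∧
        HasDerivAt (fun s => e s 1 - snellHeight α (e s 0)) 0 r) := by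
    -- Rademacher: off a null set the curve and both piecewise linear compositions are
    -- differentiable, as the chain rule at the breakpoints requires.
    filter_upwards [he.ae_differentiableAt (μ := volume), hg'.ae_differentiableAt (μ := volume),
      hh'.ae_differentiableAt (μ := volume)] with r he1 hg1 hh1
    have hx := (he1.hasDerivAt.plane_apply 0).differentiableAt.hasDerivAt
    have hy := (he1.hasDerivAt.plane_apply 1).differentiableAt.hasDerivAt
    have hFr := (hasDerivAt_snellPotential_comp (α := α) hx hg1).add (hy.const_mul α)
    have hHr := hy.sub (hasDerivAt_snellHeight_comp h0 h1 hx hh1)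
    have hsq := stripConst_sqrt_sq h0 h1 (e r 0)
    have hw := stripConst_weight_nonneg (e r 0)
    rw [norm_plane_deriv he1.hasDerivAt, show deriv F r = _ from hFr.deriv]
    refine ⟨calibration_le hw hsq, ?_⟩
    rw [calibration_eq_iff (stripConst_sqrt_pos h0 h1 _) hw hsq]
    refine and_congr_right fun _ => ⟨fun h => ?_, fun h => ?_⟩
    · rw [h, sub_self] at hHr
      exact hHr
    · exact sub_eq_zero.1 (hHr.unique h)
  have hle : deriv F ≤ᵐ[volume] fun r => stripConst 1 2 3 (e r 0) * ‖deriv e r‖ :=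
    hae.mono fun r h => h.1
  refine ⟨intervalIntegral.integral_mono_ae zero_le_one hI1 hI2 hle, ?_⟩
  -- The integrals agree exactly when their nonnegative difference vanishes almost everywhere on the
  -- interval; the reversed interval in the library statement is empty.
  rw [eq_comm, ← sub_eq_zero, ← intervalIntegral.integral_sub hI2 hI1,
    intervalIntegral.integral_eq_zero_iff_of_nonneg_ae
      (ae_restrict_of_ae (hae.mono fun r h => by simpa using h.1)) (hI2.sub hI1),
    Ioc_eq_empty (by norm_num : ¬ (1 : ℝ) < 0), union_empty, Filter.EventuallyEq,
    ae_restrict_iff' measurableSet_Ioc]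
  constructor
  · intro h
    filter_upwards [h, hae] with r hr hr' hm
    exact hr'.2.1 (by have := hr hm; simp only [Pi.zero_apply] at this; linarith)
  · intro h
    filter_upwards [h, hae] with r hr hr' hm
    simp only [Pi.zero_apply]
    linarith [hr'.2.2 (hr hm)]

end

/-! ### The shortest paths of the instance. -/

section

variable {α : ℝ}

open MeasureTheory Set

theorem stripInstance_weightedLength (γ : Path stripInstance.s stripInstance.t) :
    stripInstance.weightedLength γ =
      ∫ r in (0 : ℝ)..1, stripConst 1 2 3 (γ.extend r 0) * ‖deriv γ.extend r‖ := by
  simp only [WeightedRegionInstance.weightedLength, stripInstance_localWeight]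

theorem snell_endpoints (γ : Path stripInstance.s stripInstance.t) :
    (snellPotential α (γ.extend 1 0) + α * γ.extend 1 1) -
      (snellPotential α (γ.extend 0 0) + α * γ.extend 0 1) = snellLength α := by
  rw [← snellPotential_six, γ.extend_one, γ.extend_zero, stripInstance_s, stripInstance_t]
  simp [snellPotential_zero]
  ring

theorem snellLength_le_weightedLength (h0 : 0 < α) (h1 : α < 1)
    {γ : Path stripInstance.s stripInstance.t} (hγ : stripInstance.IsAdmissible γ) :
    snellLength α ≤ stripInstance.weightedLength γ := by
  obtain ⟨K, hK⟩ := hγ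
  have := (weighted_speed_calibration h0 h1 hK.path_extend).1
  rwa [snell_endpoints, ← stripInstance_weightedLength] at this

theorem weightedLength_eq_snellLength_iff (h0 : 0 < α) (h1 : α < 1)
    {γ : Path stripInstance.s stripInstance.t} (hγ : stripInstance.IsAdmissible γ) :
    snellLength α = stripInstance.weightedLength γ ↔
      ∀ᵐ r, r ∈ Ioc (0 : ℝ) 1 → 0 ≤ deriv (fun s => γ.extend s 0) r ∧
        HasDerivAt (fun s => γ.extend s 1 - snellHeight α (γ.extend s 0)) 0 r := by
  obtain ⟨K, hK⟩ := hγ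
  have := (weighted_speed_calibration h0 h1 hK.path_extend).2
  rwa [snell_endpoints, ← stripInstance_weightedLength] at this

theorem snellHeight_lipschitz (α : ℝ) : ∃ K, LipschitzWith K (snellHeight α) :=
  stripLinear_lipschitz _ _ _

/-- The path from `(0, 0)` to `(6, 2)` that runs along the graph of `snellHeight α`. -/
noncomputable def snellPath (α : ℝ) (hα : snellPhi α = 2) :
    Path stripInstance.s stripInstance.t where
  toFun r := !₂[6 * (r : ℝ), snellHeight α (6 * r)]
  continuous_toFun := by
    obtain ⟨K, hK⟩ := snellHeight_lipschitz α
    have := hK.continuous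
    refine (PiLp.continuous_toLp 2 _).comp (continuous_pi fun i => ?_)
    fin_cases i <;> simp <;> fun_prop
  source' := by simp [stripInstance_s, snellHeight_zero]
  target' := by simp [stripInstance_t, snellHeight_six, hα]

theorem snellPath_apply (hα : snellPhi α = 2) (r : unitInterval) :
    snellPath α hα r = !₂[6 * (r : ℝ), snellHeight α (6 * r)] := rfl

theorem snellPath_extend (hα : snellPhi α = 2) (r : ℝ) :
    (snellPath α hα).extend r = !₂[6 * (projIcc (0 : ℝ) 1 zero_le_one r : ℝ),
      snellHeight α (6 * (projIcc (0 : ℝ) 1 zero_le_one r : ℝ))] := rfl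

theorem snellPath_isAdmissible (hα : snellPhi α = 2) :
    stripInstance.IsAdmissible (snellPath α hα) := by
  obtain ⟨K, hK⟩ := snellHeight_lipschitz α
  -- The coordinates have Lipschitz constants 6 and 6K, and the Euclidean norm is at most the sum of
  -- the absolute values of the coordinates.
  refine ⟨Real.toNNReal (6 + K * 6), LipschitzWith.of_dist_le_mul fun r s => ?_⟩
  rw [Real.coe_toNNReal _ (by positivity), snellPath_apply, snellPath_apply,
    EuclideanSpace.dist_eq, Subtype.dist_eq]
  have h1 : dist (6 * (r : ℝ)) (6 * s) = 6 * dist (r : ℝ) s := by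
    rw [Real.dist_eq, Real.dist_eq, ← mul_sub, abs_mul]; norm_num
  have h2 := hK.dist_le_mul (6 * (r : ℝ)) (6 * s)
  rw [h1] at h2
  refine Real.sqrt_le_iff.2 ⟨by positivity, ?_⟩
  have h3 : 0 ≤ dist (snellHeight α (6 * r)) (snellHeight α (6 * s)) := dist_nonneg
  have h4 : 0 ≤ dist (r : ℝ) s := dist_nonneg
  have h5 : 0 ≤ (K : ℝ) * dist (r : ℝ) s := by positivity
  simp [Fin.sum_univ_two, h1]
  nlinarith

theorem snellPath_weightedLength (h0 : 0 < α) (h1 : α < 1) (hα : snellPhi α = 2) :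
    stripInstance.weightedLength (snellPath α hα) = snellLength α := by
  refine ((weightedLength_eq_snellLength_iff h0 h1 (snellPath_isAdmissible hα)).2
    (Filter.Eventually.of_forall fun r _ => ⟨?_, ?_⟩)).symm
  · have : Monotone fun s => (snellPath α hα).extend s 0 := fun s u hsu => by
      simp only [snellPath_extend]
      have := monotone_projIcc (zero_le_one' ℝ) hsu
      have : (projIcc (0 : ℝ) 1 zero_le_one s : ℝ) ≤ projIcc (0 : ℝ) 1 zero_le_one u := this
      simpa using this
    exact this.deriv_nonneg
  · have : (fun s => (snellPath α hα).extend s 1 -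
        snellHeight α ((snellPath α hα).extend s 0)) = fun _ => 0 := by
      ext s
      simp [snellPath_extend]
    rw [this]
    exact hasDerivAt_const r 0

theorem snellPath_isShortestPath (h0 : 0 < α) (h1 : α < 1) (hα : snellPhi α = 2) :
    stripInstance.IsShortestPath (snellPath α hα) :=
  ⟨snellPath_isAdmissible hα, fun _ hγ' => (snellPath_weightedLength h0 h1 hα).trans_le
    (snellLength_le_weightedLength h0 h1 hγ')⟩

theorem weightedDist_eq_snellLength (h0 : 0 < α) (h1 : α < 1) (hα : snellPhi α = 2) :
    stripInstance.weightedDist = snellLength α := by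
  have : Nonempty {γ : Path stripInstance.s stripInstance.t // stripInstance.IsAdmissible γ} :=
    ⟨⟨_, snellPath_isAdmissible hα⟩⟩
  refine le_antisymm ?_ (le_ciInf fun γ => snellLength_le_weightedLength h0 h1 γ.2)
  rw [← snellPath_weightedLength h0 h1 hα]
  refine ciInf_le (f := fun γ : {γ : Path stripInstance.s stripInstance.t //
    stripInstance.IsAdmissible γ} => stripInstance.weightedLength γ.1) ⟨snellLength α, ?_⟩
    ⟨_, snellPath_isAdmissible hα⟩
  rintro _ ⟨γ, rfl⟩
  exact snellLength_le_weightedLength h0 h1 γ.2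

/-- The graph of `snellHeight α` over `[0, 6]`. -/
def snellGraph (α : ℝ) : Set Plane := {p | p 0 ∈ Icc (0 : ℝ) 6 ∧ p 1 = snellHeight α (p 0)}

/-- A shortest path attains equality in the calibration. Its abscissa has nonnegative derivative,
hence is monotone and stays in [0, 6]. The difference between its ordinate and the height function
is absolutely continuous with derivative zero almost everywhere, hence vanishes as it does at s. The
intermediate value theorem shows that the whole graph is covered. -/
theorem range_eq_snellGraph (h0 : 0 < α) (h1 : α < 1) (hα : snellPhi α = 2)
    {γ : Path stripInstance.s stripInstance.t} (hγ : stripInstance.IsShortestPath γ) :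
    range γ = snellGraph α := by
  have hle : snellLength α = stripInstance.weightedLength γ :=
    le_antisymm (snellLength_le_weightedLength h0 h1 hγ.1)
      ((hγ.2 _ (snellPath_isAdmissible hα)).trans_eq (snellPath_weightedLength h0 h1 hα))
  have hae := (weightedLength_eq_snellLength_iff h0 h1 hγ.1).1 hle
  obtain ⟨K, hK⟩ := hγ.1
  have he := hK.path_extend
  have hx := he.plane_apply 0
  obtain ⟨Kh, hh⟩ := snellHeight_lipschitz α
  have e0 : γ.extend 0 = !₂[0, 0] := by rw [γ.extend_zero, stripInstance_s]
  have e1 : γ.extend 1 = !₂[6, 2] := by rw [γ.extend_one, stripInstance_t]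
  have hmono : ∀ a b, 0 ≤ a → a ≤ b → b ≤ 1 → γ.extend a 0 ≤ γ.extend b 0 := by
    intro a b ha hab hb
    rw [← sub_nonneg, ← hx.integral_deriv a b]
    refine intervalIntegral.integral_nonneg_of_ae_restrict hab ?_
    rw [Filter.EventuallyLE, ae_restrict_iff' measurableSet_Icc]
    -- The equality case speaks of the half-open interval only, so the left end point is discarded
    -- as a null set.
    have : ∀ᵐ r : ℝ, r ≠ 0 := by simp [ae_iff]
    filter_upwards [hae, this] with r hr hr0 hrm
    exact (hr ⟨lt_of_le_of_ne (ha.trans hrm.1) hr0.symm, hrm.2.trans hb⟩).1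
  have hgraph : ∀ r ∈ Icc (0 : ℝ) 1, γ.extend r 1 = snellHeight α (γ.extend r 0) := by
    have hL := (he.plane_apply 1).sub (hh.comp hx)
    have hac : AbsolutelyContinuousOnInterval
        (fun s => γ.extend s 1 - snellHeight α (γ.extend s 0)) 0 1 :=
      hL.lipschitzOnWith.absolutelyContinuousOnInterval
    obtain ⟨C, hC⟩ := hac.const_of_ae_hasDerivAt_zero (by
      have : ∀ᵐ r : ℝ, r ≠ 0 := by simp [ae_iff]
      filter_upwards [hae, this] with r hr hr0 hrm
      rw [uIcc_of_le zero_le_one] at hrm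
      exact (hr ⟨lt_of_le_of_ne hrm.1 hr0.symm, hrm.2⟩).2)
    rw [uIcc_of_le zero_le_one] at hC
    have hC0 := hC 0 ⟨le_rfl, zero_le_one⟩
    simp [e0, snellHeight_zero] at hC0
    intro r hr
    have := hC r hr
    linarith
  rw [← γ.extend_range]
  refine Subset.antisymm ?_ ?_
  · rw [γ.extend_range]
    rintro _ ⟨⟨r, hr⟩, rfl⟩
    rw [← γ.extend_apply hr]
    refine ⟨⟨?_, ?_⟩, hgraph r hr⟩
    · simpa [e0] using hmono 0 r le_rfl hr.1 hr.2
    · simpa [e1] using hmono r 1 hr.1 hr.2 le_rfl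
  · rintro p ⟨hp0, hp1⟩
    have hivt := intermediate_value_Icc (zero_le_one' ℝ)
      (f := fun s => γ.extend s 0) hx.continuous.continuousOn
    obtain ⟨r, hr, hrp⟩ := hivt (show p 0 ∈ Icc _ _ by simpa [e0, e1] using hp0)
    refine ⟨r, ?_⟩
    ext i
    fin_cases i
    · exact hrp
    · refine (hgraph r hr).trans ?_
      beta_reduce at hrp
      rw [hrp]
      exact hp1.symm

theorem stripLinear_of_le_one (c₁ c₂ c₃ : ℝ) {t : ℝ} (h : t ≤ 1) :
    stripLinear c₁ c₂ c₃ t = c₁ * t := by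
  unfold stripLinear
  rw [max_eq_right (by linarith), max_eq_right (by linarith)]
  ring

theorem stripLinear_of_mem_Icc (c₁ c₂ c₃ : ℝ) {t : ℝ} (h : 1 ≤ t) (h' : t ≤ 3) :
    stripLinear c₁ c₂ c₃ t = c₁ + c₂ * (t - 1) := by
  unfold stripLinear
  rw [max_eq_left (by linarith), max_eq_right (by linarith)]
  ring

theorem stripLinear_of_three_le (c₁ c₂ c₃ : ℝ) {t : ℝ} (h : 3 ≤ t) :
    stripLinear c₁ c₂ c₃ t = c₁ + 2 * c₂ + c₃ * (t - 3) := by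
  unfold stripLinear
  rw [max_eq_left (by linarith), max_eq_left (by linarith)]
  ring

/-- The part of the graph of a function over an interval on which it is affine is a segment. -/
theorem segment_eq_graph {f : ℝ → ℝ} {a b : ℝ} (hab : a < b)
    (hf : ∀ r ∈ Icc (0 : ℝ) 1, f (AffineMap.lineMap a b r) = AffineMap.lineMap (f a) (f b) r) :
    segment ℝ (!₂[a, f a] : Plane) !₂[b, f b] = {p | p 0 ∈ Icc a b ∧ p 1 = f (p 0)} := by
  rw [segment_eq_image_lineMap]
  ext p
  constructor
  · rintro ⟨r, hr, rfl⟩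
    have h0 : (AffineMap.lineMap (!₂[a, f a] : Plane) !₂[b, f b] r : Plane) 0 =
        AffineMap.lineMap a b r := by simp [AffineMap.lineMap_apply]
    have h1 : (AffineMap.lineMap (!₂[a, f a] : Plane) !₂[b, f b] r : Plane) 1 =
        AffineMap.lineMap (f a) (f b) r := by simp [AffineMap.lineMap_apply]
    rw [mem_ofPred_eq, h0, h1]
    refine ⟨?_, (hf r hr).symm⟩
    simp only [AffineMap.lineMap_apply, vsub_eq_sub, smul_eq_mul, vadd_eq_add]
    constructor <;> nlinarith [hr.1, hr.2]
  · rintro ⟨hp, hp1⟩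
    have hba : 0 < b - a := sub_pos.2 hab
    have hr : (p 0 - a) / (b - a) ∈ Icc (0 : ℝ) 1 :=
      ⟨div_nonneg (by linarith [hp.1]) hba.le, (div_le_one hba).2 (by linarith [hp.2])⟩
    have hl : AffineMap.lineMap a b ((p 0 - a) / (b - a)) = p 0 := by
      simp only [AffineMap.lineMap_apply, vsub_eq_sub, smul_eq_mul, vadd_eq_add]
      field_simp
      ring
    refine ⟨_, hr, ?_⟩
    have := hf _ hr
    rw [hl, ← hp1] at this
    ext i
    fin_cases i
    · simpa [AffineMap.lineMap_apply] using hl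
    · simpa [AffineMap.lineMap_apply] using this.symm

theorem snellHeight_lineMap_01 {r : ℝ} (hr : r ∈ Icc (0 : ℝ) 1) :
    snellHeight α (AffineMap.lineMap 0 1 r) =
      AffineMap.lineMap (snellHeight α 0) (snellHeight α 1) r := by
  simp only [AffineMap.lineMap_apply, vsub_eq_sub, smul_eq_mul, vadd_eq_add, snellHeight]
  rw [stripLinear_of_le_one _ _ _ (by linarith [hr.2]), stripLinear_of_le_one _ _ _ zero_le_one,
    stripLinear_of_le_one _ _ _ le_rfl]
  ring

theorem snellHeight_lineMap_13 {r : ℝ} (hr : r ∈ Icc (0 : ℝ) 1) :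
    snellHeight α (AffineMap.lineMap 1 3 r) =
      AffineMap.lineMap (snellHeight α 1) (snellHeight α 3) r := by
  simp only [AffineMap.lineMap_apply, vsub_eq_sub, smul_eq_mul, vadd_eq_add, snellHeight]
  rw [stripLinear_of_mem_Icc _ _ _ (by linarith [hr.1]) (by linarith [hr.2]),
    stripLinear_of_mem_Icc _ _ _ le_rfl (by norm_num),
    stripLinear_of_mem_Icc _ _ _ (by norm_num) le_rfl]
  ring

theorem snellHeight_lineMap_36 {r : ℝ} (hr : r ∈ Icc (0 : ℝ) 1) :
    snellHeight α (AffineMap.lineMap 3 6 r) =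
      AffineMap.lineMap (snellHeight α 3) (snellHeight α 6) r := by
  simp only [AffineMap.lineMap_apply, vsub_eq_sub, smul_eq_mul, vadd_eq_add, snellHeight]
  rw [stripLinear_of_three_le _ _ _ (by linarith [hr.1]),
    stripLinear_of_three_le _ _ _ le_rfl, stripLinear_of_three_le _ _ _ (by norm_num)]
  ring

theorem firstBend_eq (α : ℝ) : firstBend α = !₂[1, snellHeight α 1] := by
  rw [snellHeight_one]; rfl

theorem secondBend_eq (α : ℝ) : secondBend α = !₂[3, snellHeight α 3] := by
  rw [snellHeight_three]; rfl

theorem snell_source_eq (α : ℝ) : stripInstance.s = !₂[0, snellHeight α 0] := by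
  rw [snellHeight_zero, stripInstance_s]

theorem snell_target_eq (hα : snellPhi α = 2) : stripInstance.t = !₂[6, snellHeight α 6] := by
  rw [snellHeight_six, hα, stripInstance_t]

theorem snellGraph_eq_union (hα : snellPhi α = 2) :
    snellGraph α = segment ℝ stripInstance.s (firstBend α) ∪
      segment ℝ (firstBend α) (secondBend α) ∪ segment ℝ (secondBend α) stripInstance.t := by
  rw [snell_source_eq α, snell_target_eq hα, firstBend_eq, secondBend_eq,
    segment_eq_graph (by norm_num) fun _ => snellHeight_lineMap_01,
    segment_eq_graph (by norm_num) fun _ => snellHeight_lineMap_13,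
    segment_eq_graph (by norm_num) fun _ => snellHeight_lineMap_36]
  ext p
  simp only [snellGraph, mem_Icc, mem_union, mem_ofPred_eq]
  grind

theorem snellPath_extend_of_mem (hα : snellPhi α = 2) {r : ℝ} (hr : r ∈ Icc (0 : ℝ) 1) :
    (snellPath α hα).extend r = !₂[6 * r, snellHeight α (6 * r)] := by
  rw [snellPath_extend, projIcc_of_mem _ hr]

theorem snellPath_extend_lineMap (hα : snellPhi α = 2) {a b r : ℝ} (ha : 0 ≤ a) (ha6 : a ≤ 6)
    (hb : 0 ≤ b) (hb6 : b ≤ 6) (hr : r ∈ Icc (0 : ℝ) 1)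
    (h : snellHeight α (AffineMap.lineMap a b r) =
      AffineMap.lineMap (snellHeight α a) (snellHeight α b) r) :
    (snellPath α hα).extend (AffineMap.lineMap (a / 6) (b / 6) r) =
      AffineMap.lineMap (!₂[a, snellHeight α a] : Plane) !₂[b, snellHeight α b] r := by
  have h6 : 6 * AffineMap.lineMap (a / 6) (b / 6) r = AffineMap.lineMap a b r := by
    simp only [AffineMap.lineMap_apply, vsub_eq_sub, smul_eq_mul, vadd_eq_add]; ring
  rw [snellPath_extend_of_mem hα, h6, h]
  · ext i
    fin_cases i <;> simp [AffineMap.lineMap_apply]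
  · simp only [AffineMap.lineMap_apply, vsub_eq_sub, smul_eq_mul, vadd_eq_add]
    constructor <;> nlinarith [hr.1, hr.2]

theorem snellPath_isPolygonalChain (hα : snellPhi α = 2) :
    IsPolygonalChain (snellPath α hα)
      ![stripInstance.s, firstBend α, secondBend α, stripInstance.t] := by
  -- The abscissa at time r is 6r. The end values are left as quotients by 6 to match
  -- `snellPath_extend_lineMap`.
  refine ⟨![0 / 6, 1 / 6, 3 / 6, 6 / 6], ?_, by simp, by simp [Fin.last], fun i r hr => ?_⟩
  · refine Fin.monotone_iff_le_succ.2 fun i => ?_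
    fin_cases i <;> simp <;> norm_num
  · have hv : ![stripInstance.s, firstBend α, secondBend α, stripInstance.t] =
        ![!₂[0, snellHeight α 0], !₂[1, snellHeight α 1], !₂[3, snellHeight α 3],
          !₂[6, snellHeight α 6]] := by
      rw [snell_source_eq α, snell_target_eq hα, firstBend_eq, secondBend_eq]
    rw [hv]
    fin_cases i
    · exact snellPath_extend_lineMap hα (by norm_num) (by norm_num) (by norm_num) (by norm_num) hr
        (snellHeight_lineMap_01 hr)
    · exact snellPath_extend_lineMap hα (by norm_num) (by norm_num) (by norm_num) (by norm_num) hr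
        (snellHeight_lineMap_13 hr)
    · exact snellPath_extend_lineMap hα (by norm_num) (by norm_num) (by norm_num) (by norm_num) hr
        (snellHeight_lineMap_36 hr)

end

/-! ### The first bend is a vertex of every polygonal shortest path. -/

section

variable {α : ℝ}

open Set

/-- A segment inside the graph that contains the first bend has it as an end point. -/
theorem firstBend_eq_left_or_right (h0 : 0 < α) (h1 : α < 1) {P Q : Plane}
    (hPQ : segment ℝ P Q ⊆ snellGraph α) (hb : firstBend α ∈ segment ℝ P Q) :
    P = firstBend α ∨ Q = firstBend α := by
  have hP := hPQ (left_mem_segment ℝ P Q)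
  have hQ := hPQ (right_mem_segment ℝ P Q)
  have hP1 := hP.2
  have hQ1 := hQ.2
  by_contra! hne
  have p1 : 0 < √(1 - α ^ 2) := Real.sqrt_pos.2 (by nlinarith)
  have l1 : √(1 - α ^ 2) < √(4 - α ^ 2) := Real.sqrt_lt_sqrt (by nlinarith) (by linarith)
  have l2 : √(4 - α ^ 2) < √(9 - α ^ 2) := Real.sqrt_lt_sqrt (by nlinarith) (by linarith)
  have m1 : α / √(4 - α ^ 2) < α / √(1 - α ^ 2) := div_lt_div_of_pos_left h0 p1 l1
  have m2 : α / √(9 - α ^ 2) < α / √(4 - α ^ 2) := div_lt_div_of_pos_left h0 (by linarith) l2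
  obtain ⟨a, b, ha, hb', hab, hc⟩ := hb
  have c0 : a * P 0 + b * Q 0 = 1 := by
    have := congrArg (fun p : Plane => p 0) hc
    simpa [firstBend] using this
  have c1 : a * P 1 + b * Q 1 = snellHeight α 1 := by
    have := congrArg (fun p : Plane => p 1) hc
    rw [firstBend_eq] at this
    simpa using this
  have ha0 : a ≠ 0 := by
    rintro rfl
    rw [zero_add] at hab
    exact hne.2 (by simpa [hab] using hc)
  have hb0 : b ≠ 0 := by
    rintro rfl
    rw [add_zero] at hab
    exact hne.1 (by simpa [hab] using hc)
  have ha1 : 0 < a := lt_of_le_of_ne ha ha0.symm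
  have hb1 : 0 < b := lt_of_le_of_ne hb' hb0.symm
  rw [hP1, hQ1] at c1
  -- `stripLinear` lies strictly below its first line beyond `1`
  have habove : ∀ t, snellHeight α t ≤ snellHeight α 1 + α / √(1 - α ^ 2) * (t - 1) -
      (α / √(1 - α ^ 2) - α / √(4 - α ^ 2)) * max (t - 1) 0 := fun t => by
    simp only [snellHeight, stripLinear]
    have := le_max_right (t - 3) 0
    norm_num
    nlinarith
  have hfst : ∀ p : Plane, p ∈ snellGraph α → p 0 = 1 → p = firstBend α := fun p hp hp0 => by
    rw [firstBend_eq]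
    ext i
    fin_cases i
    · exact hp0
    · refine hp.2.trans ?_
      rw [hp0]; rfl
  have hmax : ∀ p : Plane, 0 ≤ max (p 0 - 1) 0 := fun p => le_max_right _ _
  -- Average the bound `habove` over P and Q with weights a and b. The affine part averages to the
  -- height at 1, which is already attained, so the kink terms must vanish. Both end points then
  -- have abscissa at most 1 while averaging to 1, so both equal 1.
  have hPm : max (P 0 - 1) 0 = 0 ∧ max (Q 0 - 1) 0 = 0 := by
    have hPa := mul_le_mul_of_nonneg_left (habove (P 0)) ha
    have hQa := mul_le_mul_of_nonneg_left (habove (Q 0)) hb'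
    have hsum : (α / √(1 - α ^ 2) - α / √(4 - α ^ 2)) *
        (a * max (P 0 - 1) 0 + b * max (Q 0 - 1) 0) ≤ 0 := by
      have e1 : a * snellHeight α 1 + b * snellHeight α 1 = snellHeight α 1 := by
        rw [← add_mul, hab, one_mul]
      have e2 : a * (P 0 - 1) + b * (Q 0 - 1) = 0 := by linear_combination c0 - hab
      have e3 : α / √(1 - α ^ 2) * (a * (P 0 - 1) + b * (Q 0 - 1)) = 0 := by rw [e2, mul_zero]
      linarith
    have hs : a * max (P 0 - 1) 0 + b * max (Q 0 - 1) 0 ≤ 0 := by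
      by_contra! h
      have := mul_pos (sub_pos.2 m1) h
      linarith
    have q1 := mul_nonneg ha (hmax P)
    have q2 := mul_nonneg hb' (hmax Q)
    constructor
    · have : a * max (P 0 - 1) 0 = 0 := by linarith
      exact (mul_eq_zero.1 this).resolve_left ha0
    · have : b * max (Q 0 - 1) 0 = 0 := by linarith
      exact (mul_eq_zero.1 this).resolve_left hb0
  have hP0 : P 0 ≤ 1 := by have := le_max_left (P 0 - 1) 0; linarith [hPm.1]
  have hQ0 : Q 0 ≤ 1 := by have := le_max_left (Q 0 - 1) 0; linarith [hPm.2]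
  refine hne.1 (hfst P hP (le_antisymm hP0 ?_))
  nlinarith

theorem IsPolygonalChain.exists_mem_segment {P Q : Plane} {γ : Path P Q} {m : ℕ}
    {v : Fin (m + 1) → Plane} (h : IsPolygonalChain γ v) {p : Plane} (hp : p ∈ range γ) :
    ∃ i : Fin m, p ∈ segment ℝ (v i.castSucc) (v i.succ) ∧
      segment ℝ (v i.castSucc) (v i.succ) ⊆ range γ := by
  obtain ⟨τ, hτ, hτ0, hτ1, hγ⟩ := h
  obtain ⟨⟨r, hr⟩, rfl⟩ := hp
  obtain ⟨i, hi1, hi2⟩ : ∃ i : Fin m, τ i.castSucc ≤ r ∧ r ≤ τ i.succ := by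
    -- If no parameter interval contains r, induction keeps every τ below r, and the last interval
    -- gives τ = 1 < r; for m = 0 already 0 = 1.
    by_contra! hcon
    have hall : ∀ k : Fin (m + 1), τ k ≤ r := fun k => by
      induction k using Fin.induction with
      | zero => rw [hτ0]; exact hr.1
      | succ i ih => exact (hcon i ih).le
    cases m with
    | zero =>
      rw [show Fin.last 0 = 0 from rfl, hτ0] at hτ1
      exact zero_ne_one hτ1
    | succ n =>
      have := hcon (Fin.last n) (hall _)
      rw [Fin.succ_last, hτ1] at this
      exact absurd hr.2 (not_le.2 this)
  refine ⟨i, ?_, ?_⟩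
  · have : r ∈ segment ℝ (τ i.castSucc) (τ i.succ) := by
      rw [segment_eq_Icc (hi1.trans hi2)]; exact ⟨hi1, hi2⟩
    rw [segment_eq_image_lineMap] at this ⊢
    obtain ⟨u, hu, rfl⟩ := this
    exact ⟨u, hu, by rw [← hγ i u hu, γ.extend_apply hr]⟩
  · rw [segment_eq_image_lineMap, ← γ.extend_range]
    rintro _ ⟨u, hu, rfl⟩
    exact ⟨_, hγ i u hu⟩

theorem not_isExactlySolvable_of_firstBend (h0 : 0 < α) (h1 : α < 1) (hα : snellPhi α = 2)
    (h : ¬ ACMQ ((firstBend α 1 : ℝ) : ℂ)) : ¬ stripInstance.IsExactlySolvable := by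
  rintro ⟨γ, m, v, hγ, hv, hc⟩
  have hrange := range_eq_snellGraph h0 h1 hα hγ
  have hmem : firstBend α ∈ range γ := by
    rw [hrange, firstBend_eq]
    exact ⟨by norm_num, rfl⟩
  obtain ⟨i, hi, hsub⟩ := hv.exists_mem_segment hmem
  rcases firstBend_eq_left_or_right h0 h1 (hrange ▸ hsub) hi with h' | h'
  · exact h (h' ▸ hc _ 1)
  · exact h (h' ▸ hc _ 1)

end

/-! ### Frobenius elements in Galois groups over ℚ. -/

section

open NumberField

/-- A Galois-invariant algebraic integer is rational and integral, hence an integer. This is the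
hypothesis of the general existence theorem for arithmetic Frobenius elements. -/
instance isInvariant_ringOfIntegers (K : Type*) [Field K] [NumberField K] [IsGalois ℚ K] :
    Algebra.IsInvariant ℤ (𝓞 K) Gal(K/ℚ) where
  isInvariant b hb := by
    have h1 : (b : K) ∈ (⊥ : IntermediateField ℚ K) := by
      rw [IsGalois.mem_bot_iff_fixed]
      intro σ
      exact congrArg (algebraMap (𝓞 K) K) (hb σ)
    obtain ⟨q, hq⟩ := IntermediateField.mem_bot.1 h1
    have h2 : IsIntegral ℤ q := by
      have : IsIntegral ℤ (algebraMap ℚ K q) := hq ▸ b.isIntegral_coe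
      exact (isIntegral_algebraMap_iff (algebraMap ℚ K).injective).1 this
    obtain ⟨n, rfl⟩ := IsIntegrallyClosed.isIntegral_iff.1 h2
    refine ⟨n, ?_⟩
    apply RingOfIntegers.ext
    rw [← hq]
    simp

theorem NumberField.exists_frobenius (K : Type) [Field K] [NumberField K] [IsGalois ℚ K] (p : ℕ)
    [hp : Fact p.Prime] : ∃ (k : Type) (_ : Field k) (_ : CharP k p) (π : 𝓞 K →+* k)
      (σ : Gal(K/ℚ)), ∀ x : 𝓞 K, π (σ • x) = π x ^ p := by
  have hpZ : Prime (p : ℤ) := Nat.prime_iff_prime_int.1 hp.out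
  have hmax : (Ideal.span {(p : ℤ)}).IsMaximal :=
    PrincipalIdealRing.isMaximal_of_irreducible hpZ.irreducible
  obtain ⟨Q, hQ, hQp⟩ := Ideal.exists_maximal_ideal_liesOver_of_isIntegral (S := 𝓞 K)
    (Ideal.span {(p : ℤ)})
  obtain ⟨σ, hσ⟩ := IsArithFrobAt.exists_of_isInvariant ℤ Gal(K/ℚ) Q
  have hcard : Nat.card (ℤ ⧸ Q.under ℤ) = p := by
    rw [← hQp.over, Nat.card_congr (Int.quotientSpanNatEquivZMod p).toEquiv, Nat.card_zmod]
  have hchar : CharP (𝓞 K ⧸ Q) p := by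
    refine ⟨fun n => ?_⟩
    rw [← map_natCast (Ideal.Quotient.mk Q), Ideal.Quotient.eq_zero_iff_mem,
      ← Int.natCast_dvd_natCast, ← Ideal.mem_span_singleton, hQp.over, Ideal.mem_comap, map_natCast]
  refine ⟨𝓞 K ⧸ Q, Ideal.Quotient.field Q, hchar, Ideal.Quotient.mk Q, σ, fun x => ?_⟩
  have := hσ.mk_apply x
  rwa [hcard] at this

/-- Existence of a Frobenius element at a prime `p`, in terms of a residue field. -/
theorem exists_frobenius (K : Type) [Field K] [h : Algebra ℚ K] [IsGalois ℚ K]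
    [FiniteDimensional ℚ K] (p : ℕ) [hp : Fact p.Prime] :
    ∃ (k : Type) (_ : Field k) (_ : CharP k p) (π : 𝓞 K →+* k) (σ : Gal(K/ℚ)),
      ∀ x y : 𝓞 K, (y : K) = σ x → π y = π x ^ p := by
  have : CharZero K := charZero_of_injective_algebraMap (algebraMap ℚ K).injective
  -- The ℚ-algebra structure is unique, so the given one may be replaced by the canonical one that
  -- `NumberField` uses.
  obtain rfl : h = DivisionRing.toRatAlgebra := Subsingleton.elim _ _
  have : NumberField K := ⟨⟩
  obtain ⟨k, hk, hchar, π, σ, hσ⟩ := NumberField.exists_frobenius K p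
  refine ⟨k, hk, hchar, π, σ, fun x y hxy => ?_⟩
  rw [← hσ x]
  exact congrArg π (RingOfIntegers.ext hxy)

end

/-! ### Frobenius on coefficient lists, in a form the kernel can evaluate. -/

/-- The value at `β` of the polynomial with coefficients `l`, lowest degree first. -/
def listEval {A : Type*} [CommRing A] (β : A) : List ℕ → A
  | [] => 0
  | a :: l => a + β * listEval β l

/-- Multiplication by the generator in `(ℤ/p)[β]`, where `β ^ d` has the coefficients `c`. -/
def listMulX (p : ℕ) (c l : List ℕ) : List ℕ :=
  List.zipWith (fun a b => (a + l.getLastD 0 * b) % p) (0 :: l) c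

/-- The product of the element with coefficients `pw` and the value at `β ^ p` of the polynomial
with coefficients `l`, in `(ℤ/p)[β]`, where `β ^ d` has the coefficients `c`. -/
def listFrob (p : ℕ) (c : List ℕ) : List ℕ → List ℕ → List ℕ
  | [], _ => List.replicate c.length 0
  | a :: l, pw => List.zipWith (fun x y => (a * x + y) % p) pw
      (listFrob p c l ((listMulX p c)^[p] pw))

section

variable {A : Type*} [CommRing A] {p : ℕ} [CharP A p] {β : A}

theorem natCast_mod_charP (n : ℕ) : ((n % p : ℕ) : A) = n := by
  conv_rhs => rw [← Nat.mod_add_div n p]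
  simp

theorem listEval_zipWith (f : ℕ → ℕ → ℕ) (s t : A) (hf : ∀ a b, ((f a b : ℕ) : A) = s * a + t * b) :
    ∀ l m : List ℕ, l.length = m.length →
      listEval β (List.zipWith f l m) = s * listEval β l + t * listEval β m
  | [], [], _ => by simp [listEval]
  | a :: l, b :: m, h => by
    simp only [List.zipWith_cons_cons, listEval, hf,
      listEval_zipWith f s t hf l m (by simpa using h)]
    ring

theorem listEval_append_singleton (l : List ℕ) (a : ℕ) :
    listEval β (l ++ [a]) = listEval β l + a * β ^ l.length := by
  induction l with
  | nil => simp [listEval]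
  | cons b l ih => simp only [List.cons_append, listEval, ih, List.length_cons, pow_succ]; ring

theorem zipWith_append_of_length_eq {f : ℕ → ℕ → ℕ} (l m c : List ℕ) (h : l.length = c.length) :
    List.zipWith f (l ++ m) c = List.zipWith f l c := by
  induction l generalizing c with
  | nil => cases c <;> simp_all
  | cons a l ih => cases c <;> simp_all

theorem listMulX_length {c l : List ℕ} (h : l.length = c.length) :
    (listMulX p c l).length = c.length := by
  simp [listMulX, h]

/-- After the shift, `zipWith` truncates the list to length d. The lost top coefficient t, worth
tβ^d, returns as t times the coefficients of β^d. -/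
theorem listEval_listMulX {c l : List ℕ} (hl : l.length = c.length) (hc : c ≠ [])
    (hβ : β ^ c.length = listEval β c) : listEval β (listMulX p c l) = β * listEval β l := by
  have hne : l ≠ [] := by
    rintro rfl
    exact hc (List.length_eq_zero_iff.1 hl.symm)
  obtain ⟨i, t, rfl⟩ : ∃ i t, l = i ++ [t] :=
    ⟨_, _, (List.dropLast_append_getLast hne).symm⟩
  have hlen : (0 :: i).length = c.length := by simpa using hl
  rw [listMulX, ← List.cons_append, zipWith_append_of_length_eq _ _ _ hlen,
    listEval_zipWith _ 1 (t : A) (fun a b => by rw [natCast_mod_charP]; simp) _ _ hlen, ← hβ,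
    listEval_append_singleton]
  simp only [listEval, ← hlen, List.length_cons, pow_succ]
  push_cast
  ring

theorem listMulX_iterate {c l : List ℕ} (hl : l.length = c.length) (hc : c ≠ [])
    (hβ : β ^ c.length = listEval β c) (n : ℕ) :
    ((listMulX p c)^[n] l).length = c.length ∧
      listEval β ((listMulX p c)^[n] l) = β ^ n * listEval β l := by
  induction n with
  | zero => simp [hl]
  | succ n ih =>
    rw [Function.iterate_succ_apply']
    refine ⟨listMulX_length ih.1, ?_⟩
    rw [listEval_listMulX ih.1 hc hβ, ih.2]
    ring

theorem listEval_replicate_zero (n : ℕ) : listEval β (List.replicate n 0) = 0 := by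
  induction n with
  | zero => rfl
  | succ n ih => simp [List.replicate_succ, listEval, ih]

/-- Horner evaluation at β^p: the accumulator `pw` is multiplied by β^p at each coefficient, through
p multiplications by β. -/
theorem listEval_listFrob {c : List ℕ} (hc : c ≠ []) (hβ : β ^ c.length = listEval β c)
    (l pw : List ℕ) (hpw : pw.length = c.length) :
    (listFrob p c l pw).length = c.length ∧
      listEval β (listFrob p c l pw) = listEval β pw * listEval (β ^ p) l := by
  induction l generalizing pw with
  | nil => simp [listFrob, listEval, listEval_replicate_zero]
  | cons a l ih =>
    obtain ⟨h1, h2⟩ := listMulX_iterate (p := p) hpw hc hβ p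
    obtain ⟨h3, h4⟩ := ih _ h1
    refine ⟨by simp [listFrob, h3, hpw], ?_⟩
    rw [listFrob, listEval_zipWith _ (a : A) 1 (fun x y => by rw [natCast_mod_charP]; simp) _ _
      (hpw.trans h3.symm), h4, h2, listEval]
    ring

theorem listEval_pow_char [hp : Fact p.Prime] (l : List ℕ) :
    listEval β l ^ p = listEval (β ^ p) l := by
  induction l with
  | nil => simp [listEval, hp.out.ne_zero]
  | cons a l ih =>
    have : (a : A) ^ p = a := by rw [← frobenius_def, map_natCast]
    rw [listEval, add_pow_char, mul_pow, ih, this, listEval]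

/-- In characteristic p, the p-th power of l(β) is l(β^p). One pass of `listFrob` started at 1 is
therefore Frobenius, and n passes reach the exponent p^n without computing that power directly. -/
theorem listEval_frob_iterate [hp : Fact p.Prime] {c one : List ℕ} (hc : c ≠ [])
    (hβ : β ^ c.length = listEval β c) (h1 : one.length = c.length) (h1' : listEval β one = 1)
    (n : ℕ) (l : List ℕ) :
    listEval β ((fun l => listFrob p c l one)^[n] l) = listEval β l ^ p ^ n := by
  induction n with
  | zero => simp
  | succ n ih =>
    rw [Function.iterate_succ_apply', (listEval_listFrob hc hβ _ _ h1).2, h1', one_mul,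
      ← listEval_pow_char, ih, ← pow_mul, pow_succ]

end

/-! ### Factorisations modulo 17 and 31. -/

instance : Fact (Nat.Prime 17) := ⟨by norm_num⟩
instance : Fact (Nat.Prime 31) := ⟨by norm_num⟩

section

variable {A : Type*} [CommRing A]

/-- The monic integral polynomial whose roots are `25` times the roots of `p12`. -/
def scaledP12 (t : A) : A :=
  t ^ 12 - 970 * t ^ 11 + 421075 * t ^ 10 - 105170000 * t ^ 9 + 16577796875 * t ^ 8
    - 1717416406250 * t ^ 7 + 119180751953125 * t ^ 6 - 5586569335937500 * t ^ 5
    + 176419726562500000 * t ^ 4 - 3663149414062500000 * t ^ 3 + 47282958984375000000 * t ^ 2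
    - 338159179687500000000 * t + 1001129150390625000000

/-- The quadratic factor modulo `17`. -/
def factor2 (t : A) : A := t ^ 2 + 8 * t + 4

/-- The factor of degree `10` modulo `17`, a product of two quintics. -/
def factor10 (t : A) : A :=
  t ^ 10 + 8 * t ^ 9 + 2 * t ^ 8 + 10 * t ^ 7 + 15 * t ^ 6 + 5 * t ^ 5 + 8 * t ^ 3 + 2 * t ^ 2
    + 9 * t + 2

/-- The factor of degree `11` modulo `31`. -/
def factor11 (t : A) : A :=
  t ^ 11 + 18 * t ^ 10 + 23 * t ^ 9 + 12 * t ^ 8 + 18 * t ^ 7 + 25 * t ^ 6 + 14 * t ^ 5 + 6 * t ^ 4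
    + 30 * t ^ 3 + t ^ 2 + 24 * t + 19

theorem scaledP12_mod_17 [CharP A 17] (t : A) : scaledP12 t = factor2 t * factor10 t := by
  have h : (17 : A) = 0 := by exact_mod_cast CharP.cast_eq_zero A 17
  unfold scaledP12 factor2 factor10
  -- The cofactor is the integer polynomial (`scaledP12` − `factor2` · `factor10`)/17; the same
  -- recipe with 31 is used below.
  linear_combination (-58 * t ^ 11 + 24765 * t ^ 10 - 6186474 * t ^ 9 + 975164516 * t ^ 8 -
    101024494495 * t ^ 7 + 7010632467825 * t ^ 6 - 328621725643384 * t ^ 5 +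
    10377630974264702 * t ^ 4 - 215479377297794121 * t ^ 3 + 2781350528492647054 * t ^ 2 -
    19891716452205882356 * t + 58889950022977941176) * h

theorem scaledP12_mod_31 [CharP A 31] (t : A) : scaledP12 t = (t + 4) * factor11 t := by
  have h : (31 : A) = 0 := by exact_mod_cast CharP.cast_eq_zero A 31
  unfold scaledP12 factor11
  linear_combination (-32 * t ^ 11 + 13580 * t ^ 10 - 3392584 * t ^ 9 + 534767639 * t ^ 8 -
    55400529237 * t ^ 7 + 3844540385581 * t ^ 6 - 180211914062502 * t ^ 5 +
    5690958921370966 * t ^ 4 - 118166110131048391 * t ^ 3 + 1525256741431451612 * t ^ 2 -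
    10908360635080645165 * t + 32294488722278225804) * h

theorem pow_eq_self_of_factor2 [CharP A 17] {β : A} (hβ : factor2 β = 0) : β ^ 17 ^ 2 = β := by
  have h : (17 : A) = 0 := by exact_mod_cast CharP.cast_eq_zero A 17
  -- The entries are −4 and −8 modulo 17: the defining relation solved for β². The two longer lists
  -- below arise in the same way.
  have hβ' : β ^ [13, 9].length = listEval β [13, 9] := by
    unfold factor2 at hβ
    simp only [listEval, List.length_cons, List.length_nil]
    push_cast
    linear_combination hβ - (1 + β) * h
  have hc : (fun l => listFrob 17 [13, 9] l [1, 0])^[2] [0, 1] = [0, 1] := by decide +kernel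
  have := listEval_frob_iterate (p := 17) (one := [1, 0]) (by simp) hβ' rfl (by simp [listEval])
    2 [0, 1]
  rw [hc] at this
  simpa [listEval] using this.symm

/-- Exponent 17⁵ because the factor is a product of quintics. The quintics themselves are never
needed. -/
theorem pow_eq_self_of_factor10 [CharP A 17] {β : A} (hβ : factor10 β = 0) :
    β ^ 17 ^ 5 = β := by
  have h : (17 : A) = 0 := by exact_mod_cast CharP.cast_eq_zero A 17
  have hβ' : β ^ [15, 8, 15, 9, 0, 12, 2, 7, 15, 9].length =
      listEval β [15, 8, 15, 9, 0, 12, 2, 7, 15, 9] := by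
    unfold factor10 at hβ
    simp only [listEval, List.length_cons, List.length_nil]
    push_cast
    linear_combination hβ - (1 + β + β ^ 2 + β ^ 3 + β ^ 5 + β ^ 6 + β ^ 7 + β ^ 8 + β ^ 9) * h
  have hc : (fun l => listFrob 17 [15, 8, 15, 9, 0, 12, 2, 7, 15, 9] l
      [1, 0, 0, 0, 0, 0, 0, 0, 0, 0])^[5] [0, 1, 0, 0, 0, 0, 0, 0, 0, 0] =
      [0, 1, 0, 0, 0, 0, 0, 0, 0, 0] := by decide +kernel
  have := listEval_frob_iterate (p := 17) (one := [1, 0, 0, 0, 0, 0, 0, 0, 0, 0]) (by simp) hβ' rfl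
    (by simp [listEval]) 5 [0, 1, 0, 0, 0, 0, 0, 0, 0, 0]
  rw [hc] at this
  simpa [listEval] using this.symm

theorem pow_eq_self_of_factor11 [CharP A 31] {β : A} (hβ : factor11 β = 0) :
    β ^ 31 ^ 11 = β := by
  have h : (31 : A) = 0 := by exact_mod_cast CharP.cast_eq_zero A 31
  have hβ' : β ^ [12, 7, 30, 1, 25, 17, 6, 13, 19, 8, 13].length =
      listEval β [12, 7, 30, 1, 25, 17, 6, 13, 19, 8, 13] := by
    unfold factor11 at hβ
    simp only [listEval, List.length_cons, List.length_nil]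
    push_cast
    linear_combination hβ - (1 + β + β ^ 2 + β ^ 3 + β ^ 4 + β ^ 5 + β ^ 6 + β ^ 7 + β ^ 8 + β ^ 9
      + β ^ 10) * h
  have hc : (fun l => listFrob 31 [12, 7, 30, 1, 25, 17, 6, 13, 19, 8, 13] l
      [1, 0, 0, 0, 0, 0, 0, 0, 0, 0, 0])^[11] [0, 1, 0, 0, 0, 0, 0, 0, 0, 0, 0] =
      [0, 1, 0, 0, 0, 0, 0, 0, 0, 0, 0] := by decide +kernel
  have := listEval_frob_iterate (p := 31) (one := [1, 0, 0, 0, 0, 0, 0, 0, 0, 0, 0]) (by simp) hβ'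
    rfl (by simp [listEval]) 11 [0, 1, 0, 0, 0, 0, 0, 0, 0, 0, 0]
  rw [hc] at this
  simpa [listEval] using this.symm

theorem factor11_ne_zero_mod_31 : ∀ t : ZMod 31, factor11 t ≠ 0 := by
  unfold factor11; decide +kernel

theorem scaledP12_ne_zero_mod_17 : ∀ t : ZMod 17, factor2 t * factor10 t ≠ 0 := by
  unfold factor2 factor10; decide +kernel

end

/-! ### Permutations generating the full symmetric group. -/

/-- A permutation group that contains a transposition, an element acting transitively on the
complement of a fixed point, and an element moving that point, is the full symmetric group. -/
theorem Subgroup.eq_top_of_swap_mem {ι : Type*} [Finite ι] [DecidableEq ι]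
    {H : Subgroup (Equiv.Perm ι)} {b u v : ι} {c τ : Equiv.Perm ι} (hc : c ∈ H)
    (hcyc : ∀ x y, x ≠ b → y ≠ b → ∃ n : ℕ, (c ^ n) x = y) (hcb : c b = b)
    (hτ : τ ∈ H) (hτb : τ b ≠ b) (huv : u ≠ v) (hswap : Equiv.swap u v ∈ H) : H = ⊤ := by
  have conj : ∀ g ∈ H, ∀ x y, Equiv.swap x y ∈ H → Equiv.swap (g x) (g y) ∈ H :=
    fun g hg x y h => by
      rw [Equiv.swap_apply_apply]
      exact H.mul_mem (H.mul_mem hg h) (H.inv_mem hg)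
  have hcbn : ∀ n : ℕ, (c ^ n) b = b := fun n => by
    induction n with
    | zero => rfl
    | succ n ih => rw [pow_succ, Equiv.Perm.mul_apply, hcb, ih]
  have htrans : ∀ x, ∃ g ∈ H, g x = b := fun x => by
    by_cases hx : x = b
    · exact ⟨1, H.one_mem, hx⟩
    · obtain ⟨n, hn⟩ := hcyc (τ b) x hτb hx
      refine ⟨(c ^ n * τ)⁻¹, H.inv_mem (H.mul_mem (H.pow_mem hc n) hτ), ?_⟩
      rw [Equiv.Perm.inv_eq_iff_eq, Equiv.Perm.mul_apply, hn]
  -- Conjugation moves the transposition so that it involves b; powers of c then sweep its other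
  -- entry over all remaining points.
  obtain ⟨g, hg, hgu⟩ := htrans u
  have h1 := conj g hg u v hswap
  rw [hgu] at h1
  have hgv : g v ≠ b := fun h => huv (g.injective (hgu.trans h.symm))
  have h2 : ∀ x, x ≠ b → Equiv.swap b x ∈ H := fun x hx => by
    obtain ⟨n, hn⟩ := hcyc (g v) x hgv hx
    have := conj (c ^ n) (H.pow_mem hc n) _ _ h1
    rwa [hcbn, hn] at this
  have h3 : ∀ x y, Equiv.swap x y ∈ H := fun x y => by
    by_cases hx : x = b
    · by_cases hy : y = b
      · rw [hx, hy, Equiv.swap_self]; exact H.one_mem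
      · rw [hx]; exact h2 y hy
    · by_cases hy : y = b
      · rw [hy, Equiv.swap_comm]; exact h2 x hx
      · by_cases hxy : x = y
        · rw [hxy, Equiv.swap_self]; exact H.one_mem
        -- Conjugating (b y) by (b x) gives (x y).
        · have := conj _ (h2 x hx) _ _ (h2 y hy)
          rwa [Equiv.swap_apply_left, Equiv.swap_apply_of_ne_of_ne hy (Ne.symm hxy)] at this
  rw [eq_top_iff, ← Equiv.Perm.closure_isSwap, Subgroup.closure_le]
  rintro _ ⟨x, y, -, rfl⟩
  exact h3 x y

/-- A permutation of `n + 1` points that fixes `b`, moves all other points, and has prime order `n`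
on them, permutes them transitively. -/
theorem Equiv.Perm.exists_pow_apply_eq {n : ℕ} (hn : n.Prime) {b : Fin (n + 1)}
    {c : Equiv.Perm (Fin (n + 1))} (hcb : c b = b) (hne : ∀ x, x ≠ b → c x ≠ x)
    (hpow : ∀ x, x ≠ b → (c ^ n) x = x) (x y : Fin (n + 1)) (hx : x ≠ b) (hy : y ≠ b) :
    ∃ m : ℕ, (c ^ m) x = y := by
  have hb : ∀ m : ℕ, (c ^ m) x ≠ b := fun m h => by
    have h' : (c ^ m) b = b := by
      clear h
      induction m with
      | zero => rfl
      | succ m ih => rw [pow_succ, Equiv.Perm.mul_apply, hcb, ih]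
    exact hx ((c ^ m).injective (h.trans h'.symm))
  have : Fact n.Prime := ⟨hn⟩
  have hper : Function.minimalPeriod c x = n :=
    Function.minimalPeriod_eq_prime
      (show c^[n] x = x by rw [← Equiv.Perm.coe_pow]; exact hpow x hx) (hne x hx)
  have hinj : Set.InjOn (fun m : ℕ => (c ^ m) x) (Finset.range n : Set ℕ) := fun i hi j hj hij => by
    simp only [Finset.coe_range, Set.mem_Iio] at hi hj
    rw [← hper] at hi hj
    refine Function.iterate_injOn_Iio_minimalPeriod hi hj ?_
    simpa only [Equiv.Perm.coe_pow] using hij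
  -- The orbit consists of n distinct points avoiding b, and only n such points exist.
  have hcard : ((Finset.range n).image fun m => (c ^ m) x) = Finset.univ.erase b := by
    refine Finset.eq_of_subset_of_card_le (fun z hz => ?_) ?_
    · obtain ⟨m, -, rfl⟩ := Finset.mem_image.1 hz
      exact Finset.mem_erase.2 ⟨hb m, Finset.mem_univ _⟩
    · rw [Finset.card_image_of_injOn hinj]
      simp
  have : y ∈ ((Finset.range n).image fun m => (c ^ m) x) := by
    rw [hcard]; exact Finset.mem_erase.2 ⟨hy, Finset.mem_univ _⟩
  obtain ⟨m, -, h⟩ := Finset.mem_image.1 this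
  exact ⟨m, h⟩

/-! ### Cycle types of Frobenius on the roots. -/

section

variable {k : Type*} [Field k]

/-- Applied to the adjoined root, the hypothesis says that g divides X^(p^m) − X, which is
separable. Since g need not be irreducible, `AdjoinRoot g` is only a ring, which is why the list
computations were done over commutative rings. -/
theorem separable_of_pow_eq_self {p m : ℕ} [Fact p.Prime] [CharP k p] (hm : m ≠ 0) {g : k[X]}
    (hg : g.degree ≠ 0)
    (h : ∀ β : AdjoinRoot g, CharP (AdjoinRoot g) p → aeval β g = 0 → β ^ p ^ m = β) :
    g.Separable := by
  have hn := AdjoinRoot.nontrivial g hg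
  have hp : CharP (AdjoinRoot g) p := charP_of_injective_algebraMap
    (algebraMap k (AdjoinRoot g)).injective p
  have h1 := h (AdjoinRoot.root g) hp (by rw [AdjoinRoot.aeval_eq, AdjoinRoot.mk_self])
  have h2 : g ∣ X ^ p ^ m - X := by
    rw [← AdjoinRoot.mk_eq_zero]
    simp [h1]
  exact (galois_poly_separable p (p ^ m) (dvd_pow_self p hm)).of_dvd h2

/-- Elements fixed by Frobenius lie in the prime field. This carries the exhaustive checks over
`ZMod p` to any field of characteristic p. -/
theorem exists_natCast_of_pow_char_eq_self (p : ℕ) [Fact p.Prime] [CharP k p] {γ : k}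
    (h : γ ^ p = γ) : ∃ a : ZMod p, ZMod.castHom dvd_rfl k a = γ := by
  have h1 := (Subfield.mem_bot_iff_pow_eq_self k p).2 h
  rw [← ZMod.fieldRange_castHom_eq_bot p] at h1
  exact h1

theorem map_factor2 {A B : Type*} [CommRing A] [CommRing B] (φ : A →+* B) (t : A) :
    φ (factor2 t) = factor2 (φ t) := by
  simp only [factor2, map_add, map_mul, map_pow, map_ofNat]

theorem map_factor10 {A B : Type*} [CommRing A] [CommRing B] (φ : A →+* B) (t : A) :
    φ (factor10 t) = factor10 (φ t) := by
  simp only [factor10, map_add, map_mul, map_pow, map_ofNat]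

theorem map_factor11 {A B : Type*} [CommRing A] [CommRing B] (φ : A →+* B) (t : A) :
    φ (factor11 t) = factor11 (φ t) := by
  simp only [factor11, map_add, map_mul, map_pow, map_ofNat]

theorem factor11_ne_of_pow_eq [CharP k 31] {γ : k} (h : γ ^ 31 = γ) : factor11 γ ≠ 0 := by
  obtain ⟨a, rfl⟩ := exists_natCast_of_pow_char_eq_self 31 h
  have := factor11_ne_zero_mod_31 a
  rw [← (map_ne_zero (ZMod.castHom (dvd_refl 31) k))] at this
  rwa [map_factor11] at this

theorem factors_ne_of_pow_eq [CharP k 17] {γ : k} (h : γ ^ 17 = γ) :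
    factor2 γ * factor10 γ ≠ 0 := by
  obtain ⟨a, rfl⟩ := exists_natCast_of_pow_char_eq_self 17 h
  have := scaledP12_ne_zero_mod_17 a
  rw [← (map_ne_zero (ZMod.castHom (dvd_refl 17) k))] at this
  rwa [map_mul, map_factor2, map_factor10] at this

/-- A common root would be fixed by the second and the fifth power of Frobenius, hence by Frobenius
since 5 = 2 + 2 + 1; but there is no root in the prime field. -/
theorem factor2_factor10_ne [CharP k 17] {γ : k} (h2 : factor2 γ = 0) (h10 : factor10 γ = 0) :
    False := by
  have e2 := pow_eq_self_of_factor2 h2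
  have e5 := pow_eq_self_of_factor10 h10
  have e1 : γ ^ 17 = γ := by
    calc γ ^ 17 = (((γ ^ 17 ^ 2) ^ 17 ^ 2)) ^ 17 := by rw [e2, e2]
      _ = γ ^ 17 ^ 5 := by rw [← pow_mul, ← pow_mul]; norm_num
      _ = γ := e5
  exact factors_ne_of_pow_eq e1 (by rw [h2, zero_mul])

theorem aeval_factor2 {A : Type*} [CommRing A] [Algebra k A] (β : A) :
    aeval β (factor2 (X : k[X])) = factor2 β := by
  rw [← RingHom.coe_coe, map_factor2, RingHom.coe_coe, aeval_X]

theorem aeval_factor10 {A : Type*} [CommRing A] [Algebra k A] (β : A) :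
    aeval β (factor10 (X : k[X])) = factor10 β := by
  rw [← RingHom.coe_coe, map_factor10, RingHom.coe_coe, aeval_X]

theorem aeval_factor11 {A : Type*} [CommRing A] [Algebra k A] (β : A) :
    aeval β (factor11 (X : k[X])) = factor11 β := by
  rw [← RingHom.coe_coe, map_factor11, RingHom.coe_coe, aeval_X]

theorem eval_factor2 (t : k) : eval t (factor2 (X : k[X])) = factor2 t := by
  rw [← coe_aeval_eq_eval, aeval_factor2]

theorem eval_factor10 (t : k) : eval t (factor10 (X : k[X])) = factor10 t := by
  rw [← coe_aeval_eq_eval, aeval_factor10]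

theorem eval_factor11 (t : k) : eval t (factor11 (X : k[X])) = factor11 t := by
  rw [← coe_aeval_eq_eval, aeval_factor11]

theorem degree_factor2 : (factor2 (X : k[X])).degree = 2 := by
  unfold factor2; compute_degree!

theorem degree_factor10 : (factor10 (X : k[X])).degree = 10 := by
  unfold factor10; compute_degree!

theorem natDegree_factor10 : (factor10 (X : k[X])).natDegree = 10 := by
  unfold factor10; compute_degree!

theorem degree_factor11 : (factor11 (X : k[X])).degree = 11 := by
  unfold factor11; compute_degree!

theorem separable_scaledP12_31 [CharP k 31] : (scaledP12 (X : k[X])).Separable := by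
  rw [scaledP12_mod_31]
  refine Separable.mul ?_ ?_ ?_
  · exact separable_X_add_C (4 : k)
  · refine separable_of_pow_eq_self (p := 31) (m := 11) (by norm_num)
      (by rw [degree_factor11]; norm_num) fun β _ hβ => ?_
    rw [aeval_factor11] at hβ
    exact pow_eq_self_of_factor11 hβ
  · rw [isCoprime_iff_aeval_ne_zero_of_isAlgClosed k (AlgebraicClosure k)]
    intro a
    by_contra! h
    have hchar : CharP (AlgebraicClosure k) 31 := charP_of_injective_algebraMap
      (algebraMap k (AlgebraicClosure k)).injective 31
    rw [aeval_factor11] at h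
    have h4 : a = ((-4 : ℤ) : AlgebraicClosure k) := by
      have := h.1
      simp only [map_add, aeval_X, map_ofNat] at this
      push_cast
      linear_combination this
    refine factor11_ne_of_pow_eq ?_ h.2
    rw [h4, ← frobenius_def, map_intCast]

theorem separable_scaledP12_17 [CharP k 17] : (scaledP12 (X : k[X])).Separable := by
  rw [scaledP12_mod_17]
  refine Separable.mul ?_ ?_ ?_
  · refine separable_of_pow_eq_self (p := 17) (m := 2) (by norm_num)
      (by rw [degree_factor2]; norm_num) fun β _ hβ => ?_
    rw [aeval_factor2] at hβ
    exact pow_eq_self_of_factor2 hβ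
  · refine separable_of_pow_eq_self (p := 17) (m := 5) (by norm_num)
      (by rw [degree_factor10]; norm_num) fun β _ hβ => ?_
    rw [aeval_factor10] at hβ
    exact pow_eq_self_of_factor10 hβ
  · rw [isCoprime_iff_aeval_ne_zero_of_isAlgClosed k (AlgebraicClosure k)]
    intro a
    by_contra! h
    have hchar : CharP (AlgebraicClosure k) 17 := charP_of_injective_algebraMap
      (algebraMap k (AlgebraicClosure k)).injective 17
    rw [aeval_factor2, aeval_factor10] at h
    exact factor2_factor10_ne h.1 h.2

/-- A Frobenius element at `31` permutes the roots of `scaledP12` as an `11`-cycle. -/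
theorem frobenius_31_cycle [CharP k 31] {v : Fin 12 → k}
    (hv : scaledP12 (X : k[X]) = ∏ i, (X - C (v i))) {c : Equiv.Perm (Fin 12)}
    (hc : ∀ i, v (c i) = v i ^ 31) :
    ∃ b, c b = b ∧ ∀ x y, x ≠ b → y ≠ b → ∃ n : ℕ, (c ^ n) x = y := by
  have hinj : Function.Injective v := by
    rw [← separable_prod_X_sub_C_iff, ← hv]
    exact separable_scaledP12_31
  have heval : ∀ t : k, (t + 4) * factor11 t = ∏ i, (t - v i) := fun t => by
    have := congrArg (eval t) hv
    rw [eval_prod, scaledP12_mod_31] at this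
    simpa [eval_factor11] using this
  obtain ⟨b, -, hb⟩ : ∃ b ∈ Finset.univ, -4 - v b = 0 := by
    rw [← Finset.prod_eq_zero_iff, ← heval]; ring
  have hb4 : v b = ((-4 : ℤ) : k) := by push_cast; linear_combination -hb
  have hcb : c b = b := hinj (by rw [hc, hb4, ← frobenius_def, map_intCast])
  have hx11 : ∀ x, x ≠ b → factor11 (v x) = 0 := fun x hx => by
    have h1 := heval (v x)
    rw [Finset.prod_eq_zero (Finset.mem_univ x) (sub_self _), mul_eq_zero] at h1
    refine h1.resolve_left fun h => hx (hinj ?_)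
    rw [hb4]; push_cast; linear_combination h
  have hcn : ∀ n x, v ((c ^ n) x) = v x ^ 31 ^ n := fun n x => by
    induction n with
    | zero => simp
    | succ n ih => rw [pow_succ', Equiv.Perm.mul_apply, hc, ih, ← pow_mul, pow_succ]
  -- Away from b, Frobenius has no fixed point because `factor11` has no root in the prime field,
  -- while its eleventh power is trivial; 11 is prime.
  refine ⟨b, hcb, Equiv.Perm.exists_pow_apply_eq (by norm_num) hcb (fun x hx h => ?_)
    fun x hx => hinj ?_⟩
  · exact factor11_ne_of_pow_eq (by rw [← hc, h]) (hx11 x hx)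
  · rw [hcn, pow_eq_self_of_factor11 (hx11 x hx)]

/-- The fifth power of a Frobenius element at `17` is a transposition of the roots of
`scaledP12`, and a Frobenius element has no fixed point. -/
theorem frobenius_17_swap [CharP k 17] {v : Fin 12 → k}
    (hv : scaledP12 (X : k[X]) = ∏ i, (X - C (v i))) {c : Equiv.Perm (Fin 12)}
    (hc : ∀ i, v (c i) = v i ^ 17) :
    (∀ i, c i ≠ i) ∧ ∃ x y, x ≠ y ∧ c ^ 5 = Equiv.swap x y := by
  have hinj : Function.Injective v := by
    rw [← separable_prod_X_sub_C_iff, ← hv]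
    exact separable_scaledP12_17
  have heval : ∀ t : k, factor2 t * factor10 t = ∏ i, (t - v i) := fun t => by
    have := congrArg (eval t) hv
    rw [eval_prod, scaledP12_mod_17] at this
    simpa [eval_factor2, eval_factor10] using this
  have hroot : ∀ i, factor2 (v i) = 0 ∨ factor10 (v i) = 0 := fun i => by
    rw [← mul_eq_zero, heval, Finset.prod_eq_zero (Finset.mem_univ i) (sub_self _)]
  have hfix : ∀ i, c i ≠ i := fun i h => by
    refine factors_ne_of_pow_eq (γ := v i) (by rw [← hc, h]) ?_
    rw [heval, Finset.prod_eq_zero (Finset.mem_univ i) (sub_self _)]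
  have hcn : ∀ n x, v ((c ^ n) x) = v x ^ 17 ^ n := fun n x => by
    induction n with
    | zero => simp
    | succ n ih => rw [pow_succ', Equiv.Perm.mul_apply, hc, ih, ← pow_mul, pow_succ]
  have h10 : ∀ i, factor10 (v i) = 0 → (c ^ 5) i = i := fun i hi =>
    hinj (by rw [hcn, pow_eq_self_of_factor10 hi])
  have h2 : ∀ i, factor2 (v i) = 0 → (c ^ 2) i = i := fun i hi =>
    hinj (by rw [hcn, pow_eq_self_of_factor2 hi])
  have h25 : ∀ i, factor2 (v i) = 0 → (c ^ 5) i = c i := fun i hi => by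
    have : c ^ 5 = c * c ^ 2 * c ^ 2 := by rw [mul_assoc, ← pow_add, ← pow_succ']
    rw [this, Equiv.Perm.mul_apply, h2 i hi, Equiv.Perm.mul_apply, h2 i hi]
  -- Otherwise the factor of degree 10 would have twelve distinct roots.
  obtain ⟨x, hx⟩ : ∃ x, factor2 (v x) = 0 := by
    by_contra! hcon
    classical
    have hz : ∀ i, (factor10 (X : k[X])).IsRoot (v i) := fun i => by
      have := (hroot i).resolve_left (hcon i)
      rw [IsRoot, eval_factor10, this]
    have hne : factor10 (X : k[X]) ≠ 0 := fun h => by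
      have := degree_factor10 (k := k)
      rw [h] at this
      simp at this
    have h1 : (Finset.univ.image v).card ≤ (factor10 (X : k[X])).natDegree :=
      card_le_degree_of_subset_roots fun a ha => by
        rw [Finset.mem_val, Finset.mem_image] at ha
        obtain ⟨i, -, rfl⟩ := ha
        exact (mem_roots hne).2 (hz i)
    rw [Finset.card_image_of_injective _ hinj, natDegree_factor10] at h1
    simp at h1
  have hcx : factor2 (v (c x)) = 0 := by
    have : factor2 (v (c x)) = frobenius k 17 (factor2 (v x)) := by
      rw [map_factor2, frobenius_def, hc]
    rw [this, hx, map_zero]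
  have hxc : x ≠ c x := (hfix x).symm
  -- Vieta for the quadratic factor; it shows below that x and c x index all of its roots.
  have hsum : v x + v (c x) = -8 := by
    have e : (v x - v (c x)) * (v x + v (c x) + 8) = 0 := by
      unfold factor2 at hx hcx
      linear_combination hx - hcx
    have := (mul_eq_zero.1 e).resolve_left (sub_ne_zero.2 (hinj.ne hxc))
    linear_combination this
  refine ⟨hfix, x, c x, hxc, Equiv.ext fun z => ?_⟩
  by_cases hzx : z = x
  · rw [hzx, Equiv.swap_apply_left, h25 x hx]
  by_cases hzc : z = c x
  · rw [hzc, Equiv.swap_apply_right, h25 _ hcx]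
    have := h2 x hx
    rwa [pow_two, Equiv.Perm.mul_apply] at this
  rw [Equiv.swap_apply_of_ne_of_ne hzx hzc]
  refine h10 z ((hroot z).resolve_left fun hz => ?_)
  have e : (v z - v x) * (v z - v (c x)) = 0 := by
    have hz' := hz
    unfold factor2 at hz' hx
    have e2 : v (c x) = -8 - v x := by linear_combination hsum
    rw [e2]
    linear_combination hz' - hx
  rcases mul_eq_zero.1 e with e | e
  · exact hzx (hinj (sub_eq_zero.1 e))
  · exact hzc (hinj (sub_eq_zero.1 e))

end

/-! ### The Galois group of p₁₂. -/

section

open NumberField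

theorem map_scaledP12 {A B : Type*} [CommRing A] [CommRing B] (φ : A →+* B) (t : A) :
    φ (scaledP12 t) = scaledP12 (φ t) := by
  simp only [scaledP12, map_add, map_sub, map_mul, map_pow, map_ofNat]

theorem natDegree_p12 : p12.natDegree = 12 := by
  unfold p12; compute_degree!

theorem p12_leadingCoeff : p12.leadingCoeff = 25 := by
  rw [leadingCoeff, natDegree_p12]
  unfold p12
  compute_degree!

theorem p12_ne_zero : p12 ≠ 0 := fun h => by
  have := natDegree_p12
  rw [h] at this
  simp at this

theorem scaledP12_smul {K : Type*} [Field K] [Algebra ℚ K] (t : K) :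
    scaledP12 (25 * t) = 25 ^ 11 * aeval t p12 := by
  simp only [scaledP12, p12, map_add, map_sub, map_mul, map_pow, aeval_X, map_ofNat]
  ring

theorem Multiset.exists_map_univ_eq {β : Type*} {n : ℕ} (s : Multiset β) (hs : s.card = n) :
    ∃ u : Fin n → β, Finset.univ.val.map u = s := by
  subst hs
  refine ⟨fun i => s.toList.get (i.cast s.length_toList.symm), ?_⟩
  conv_rhs => rw [← s.coe_toList, ← List.ofFn_get s.toList]
  rw [Fin.univ_val_map, List.ofFn_congr s.length_toList.symm]
  rfl

variable (K : Type) [Field K] [Algebra ℚ K] [IsSplittingField ℚ K p12]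

theorem exists_p12_eq_prod : ∃ u : Fin 12 → K, ∀ t : K, aeval t p12 = 25 * ∏ i, (t - u i) := by
  have hs : (p12.map (algebraMap ℚ K)).Splits := IsSplittingField.splits K p12
  obtain ⟨u, hu⟩ := Multiset.exists_map_univ_eq (p12.map (algebraMap ℚ K)).roots (n := 12)
    (by rw [← hs.natDegree_eq_card_roots, natDegree_map, natDegree_p12])
  refine ⟨u, fun t => ?_⟩
  rw [← eval_map_algebraMap, hs.eq_prod_roots, eval_mul, eval_C, leadingCoeff_map,
    p12_leadingCoeff, map_ofNat, ← hu, Multiset.map_map, eval_multiset_prod, Multiset.map_map]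
  simp [Finset.prod]

/-- The leading coefficient is 25, so scaling the roots by 25 makes them integral. The resulting
factorisation over 𝓞 K can be reduced along any residue map. -/
theorem exists_integral_roots : ∃ r : Fin 12 → 𝓞 K,
    (∀ t : K, aeval t p12 = 0 ↔ ∃ i, 25 * t = r i) ∧
      scaledP12 (X : (𝓞 K)[X]) = ∏ i, (X - C (r i)) := by
  have : CharZero K := charZero_of_injective_algebraMap (algebraMap ℚ K).injective
  obtain ⟨u, hu⟩ := exists_p12_eq_prod K
  have h25 : (25 : K) ≠ 0 := by norm_num
  have hint : ∀ i, IsIntegral ℤ (25 * u i) := fun i => by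
    refine ⟨scaledP12 X, ?_, ?_⟩
    · unfold scaledP12; monicity!
    · rw [← aeval_def, ← RingHom.coe_coe, map_scaledP12, RingHom.coe_coe, aeval_X, scaledP12_smul,
        hu, Finset.prod_eq_zero (Finset.mem_univ i) (sub_self _), mul_zero, mul_zero]
  choose r hr using fun i => IsIntegralClosure.isIntegral_iff (A := 𝓞 K).1 (hint i)
  refine ⟨r, fun t => ?_, ?_⟩
  · rw [hu, mul_eq_zero, or_iff_right h25, Finset.prod_eq_zero_iff]
    simp only [Finset.mem_univ, true_and, sub_eq_zero]
    refine exists_congr fun i => ?_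
    rw [← mul_right_inj' h25, ← hr]
  · apply map_injective (algebraMap (𝓞 K) K) RingOfIntegers.coe_injective
    refine Polynomial.funext fun s => ?_
    rw [← coe_mapRingHom, map_scaledP12, coe_mapRingHom, map_X, ← coe_evalRingHom, map_scaledP12,
      coe_evalRingHom, eval_X, Polynomial.map_prod, eval_prod]
    simp only [Polynomial.map_sub, map_X, map_C, eval_sub, eval_X, eval_C, hr]
    have hs : s = 25 * (s / 25) := by field_simp
    calc scaledP12 s = 25 ^ 12 * ∏ i, (s / 25 - u i) := by
          rw [hs, scaledP12_smul, hu, ← hs]; ring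
      _ = ∏ i, (25 * (s / 25 - u i)) := by
          rw [Finset.prod_mul_distrib, Finset.prod_const, Finset.card_univ, Fintype.card_fin]
      _ = ∏ i, (s - 25 * u i) := by
          refine Finset.prod_congr rfl fun i _ => ?_
          rw [mul_sub, ← hs]

/-- The Galois group acts on the roots of `p12` as the full symmetric group. -/
theorem exists_gal_mulEquiv_perm : ∃ (u : Fin 12 → K)
    (e : Gal(K/ℚ) ≃* Equiv.Perm (Fin 12)), Function.Injective u ∧
      (∀ t, aeval t p12 = 0 ↔ ∃ i, t = u i) ∧ ∀ (σ : Gal(K/ℚ)) i, σ (u i) = u (e σ i) := by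
  have : CharZero K := charZero_of_injective_algebraMap (algebraMap ℚ K).injective
  have : Normal ℚ K := Normal.of_isSplittingField p12
  have : IsGalois ℚ K := ⟨⟩
  have : FiniteDimensional ℚ K := IsSplittingField.finiteDimensional K p12
  obtain ⟨r, hr, hprod⟩ := exists_integral_roots K
  have hmap : ∀ (k : Type) [Field k] (π : 𝓞 K →+* k),
      scaledP12 (X : k[X]) = ∏ i, (X - C (π (r i))) := fun k _ π => by
    have := congrArg (Polynomial.map π) hprod
    rw [← coe_mapRingHom, map_scaledP12, coe_mapRingHom, map_X, Polynomial.map_prod] at this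
    simpa only [Polynomial.map_sub, map_X, map_C] using this
  obtain ⟨k, _, _, π, σ, hσ⟩ := exists_frobenius K 17
  obtain ⟨k', _, _, π', σ', hσ'⟩ := exists_frobenius K 31
  -- The roots are distinct in characteristic zero because their reductions modulo 17 are.
  have hinj : Function.Injective fun i => (r i : K) := by
    have : Function.Injective fun i => π (r i) := by
      rw [← separable_prod_X_sub_C_iff, ← hmap k π]
      exact separable_scaledP12_17
    exact fun i j hij => this (congrArg π (RingOfIntegers.ext hij))
  have hroot : ∀ t : K, aeval t p12 = 0 ↔ ∃ i, t = r i / 25 := fun t => by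
    rw [hr]
    refine exists_congr fun i => ?_
    rw [eq_div_iff (by norm_num), mul_comm]
  have hact : ∀ (τ : Gal(K/ℚ)) i, ∃ j, (r j : K) = τ (r i) := fun τ i => by
    have h1 : aeval (r i / 25 : K) p12 = 0 := (hroot _).2 ⟨i, rfl⟩
    have h2 : aeval (τ (r i / 25 : K)) p12 = 0 := by rw [aeval_algHom_apply, h1, map_zero]
    obtain ⟨j, hj⟩ := (hroot _).1 h2
    refine ⟨j, ?_⟩
    rw [map_div₀, map_ofNat] at hj
    field_simp at hj
    exact hj.symm
  choose f hf using hact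
  let F : Gal(K/ℚ) →* Function.End (Fin 12) :=
    { toFun := f
      map_one' := funext fun i => hinj (hf 1 i)
      map_mul' := fun a b => funext fun i => hinj
        ((hf _ _).trans ((hf a _).trans (congrArg _ (hf b i))).symm) }
  let E : Gal(K/ℚ) →* Equiv.Perm (Fin 12) := F.toHomPerm
  have hE : ∀ τ i, (r (E τ i) : K) = τ (r i) := hf
  have hact' : ∀ (τ : Gal(K/ℚ)) i, τ (r i / 25 : K) = r (E τ i) / 25 :=
    fun τ i => by rw [map_div₀, map_ofNat, hE]
  have hEinj : Function.Injective E := fun τ τ' h => by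
    have h1 : (τ : K →ₐ[ℚ] K) = τ' := by
      refine AlgHom.ext_of_adjoin_eq_top (IsSplittingField.adjoin_rootSet K p12) fun x hx => ?_
      obtain ⟨i, rfl⟩ := (hroot x).1 (mem_rootSet.1 hx).2
      exact (hact' τ i).trans (h ▸ (hact' τ' i).symm)
    exact AlgEquiv.ext fun x => DFunLike.congr_fun h1 x
  have hEsurj : Function.Surjective E := by
    rw [← MonoidHom.range_eq_top]
    -- The Frobenius at 17 plays two roles: its fifth power is the transposition, and it moves the
    -- point b fixed by the Frobenius at 31.
    obtain ⟨hfix, x, y, hxy, hswap⟩ := frobenius_17_swap (hmap k π) (c := E σ)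
      fun i => hσ _ _ (hE σ i)
    obtain ⟨b, hb, hcyc⟩ := frobenius_31_cycle (hmap k' π') (c := E σ')
      fun i => hσ' _ _ (hE σ' i)
    refine Subgroup.eq_top_of_swap_mem ⟨σ', rfl⟩ hcyc hb ⟨σ, rfl⟩ (hfix b) hxy ⟨σ ^ 5, ?_⟩
    rw [map_pow, hswap]
  refine ⟨fun i => r i / 25, MulEquiv.ofBijective E ⟨hEinj, hEsurj⟩, fun i j hij => ?_, hroot,
    hact'⟩
  exact hinj (by simpa using hij)

theorem nonempty_gal_p12_mulEquiv_perm : Nonempty (p12.Gal ≃* Equiv.Perm (Fin 12)) := by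
  obtain ⟨-, e, -⟩ := @exists_gal_mulEquiv_perm p12.SplittingField _ _
    (IsSplittingField.splittingField p12)
  exact ⟨e⟩

end

/-! ### Radicals, subfields of ℚ(α²), and the rationalised weighted length. -/

section

open IntermediateField

theorem ACMQ.mem_solvableByRad {x : ℂ} (h : ACMQ x) : x ∈ solvableByRad ℚ ℂ := by
  induction h with
  | rat q => exact (eq_ratCast (algebraMap ℚ ℂ) q) ▸ _root_.algebraMap_mem _ q
  | add _ _ h1 h2 => exact add_mem h1 h2
  | sub _ _ h1 h2 => exact sub_mem h1 h2
  | mul _ _ h1 h2 => exact mul_mem h1 h2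
  | div _ _ _ h1 h2 => exact div_mem h1 h2
  | root hk _ hy h => exact solvableByRad.rad_mem (by omega) (hy ▸ h)

/-- The Galois action is transitive, so the minimal polynomial of one root vanishes at all twelve
and the complementary factor is constant. -/
theorem irreducible_p12 : Irreducible p12 := by
  obtain ⟨u, e, hu, hroot, he⟩ := @exists_gal_mulEquiv_perm p12.SplittingField _ _
    (IsSplittingField.splittingField p12)
  have h0 : aeval (u 0) p12 = 0 := (hroot _).2 ⟨0, rfl⟩
  have hint : IsIntegral ℚ (u 0) := (isAlgebraic_iff_isIntegral.1 ⟨p12, p12_ne_zero, h0⟩)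
  have hm := minpoly.ne_zero hint
  have hall : ∀ i, aeval (u i) (minpoly ℚ (u 0)) = 0 := fun i => by
    have h1 := he (e.symm (Equiv.swap 0 i)) 0
    rw [e.apply_symm_apply, Equiv.swap_apply_left] at h1
    rw [← h1, aeval_algHom_apply, minpoly.aeval, map_zero]
  have hdeg : 12 ≤ (minpoly ℚ (u 0)).natDegree := by
    classical
    have h1 : (Finset.univ.image u).card ≤
        ((minpoly ℚ (u 0)).map (algebraMap ℚ p12.SplittingField)).natDegree :=
      card_le_degree_of_subset_roots fun a ha => by
        rw [Finset.mem_val, Finset.mem_image] at ha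
        obtain ⟨i, -, rfl⟩ := ha
        rw [mem_roots (map_ne_zero hm), IsRoot, eval_map_algebraMap]
        exact hall i
    rwa [Finset.card_image_of_injective _ hu, natDegree_map, Finset.card_univ,
      Fintype.card_fin] at h1
  obtain ⟨q, hq⟩ := minpoly.dvd ℚ (u 0) h0
  have hq0 : q ≠ 0 := by
    rintro rfl
    exact p12_ne_zero (by rw [hq, mul_zero])
  have hqd : q.natDegree = 0 := by
    have := natDegree_p12
    rw [hq, natDegree_mul hm hq0] at this
    omega
  rw [hq, irreducible_mul_isUnit (isUnit_iff_degree_eq_zero.2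
    (by rw [degree_eq_natDegree hq0, hqd]; rfl))]
  exact minpoly.irreducible hint

theorem not_isSolvable_perm_fin_twelve : ¬ Group.IsSolvable (Equiv.Perm (Fin 12)) :=
  Equiv.Perm.not_isSolvable (Fin 12) (by simp; norm_num)

theorem notMem_solvableByRad_of_aeval_p12 {a : ℂ} (ha : aeval a p12 = 0) :
    a ∉ solvableByRad ℚ ℂ := fun h => by
  obtain ⟨e⟩ := nonempty_gal_p12_mulEquiv_perm
  have := isSolvable_gal_of_irreducible h irreducible_p12 ha
  exact not_isSolvable_perm_fin_twelve
    (Group.isSolvable_of_surjective (f := e.toMonoidHom) e.surjective)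

/-- An automorphism that fixes the generator of a simple extension fixes all its elements. -/
theorem apply_eq_self_of_mem_adjoin_simple {F K : Type*} [Field F] [Field K] [Algebra F K]
    {a x : K} (hx : x ∈ F⟮a⟯) {σ : Gal(K/F)} (hσ : σ a = a) : σ x = x := by
  induction hx using adjoin_induction with
  | mem y hy => rw [Set.mem_singleton_iff.1 hy, hσ]
  | algebraMap q => exact σ.commutes q
  | add y z _ _ hy hz => rw [map_add, hy, hz]
  | inv y _ hy => rw [map_inv₀, hy]
  | mul y z _ _ hy hz => rw [map_mul, hy, hz]

/-- If the Galois group acts on the roots `u` as the full symmetric group, an element of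
`F(u i)` either is fixed by the Galois group or generates `F(u i)`. -/
theorem fixed_or_mem_adjoin {F K ι : Type*} [Field F] [Field K] [Algebra F K]
    [FiniteDimensional F K] [IsGalois F K] [DecidableEq ι] {u : ι → K}
    (e : Gal(K/F) ≃* Equiv.Perm ι)
    (he : ∀ (σ : Gal(K/F)) i, σ (u i) = u (e σ i)) {i : ι} {x : K} (hx : x ∈ F⟮u i⟯) :
    (∀ σ : Gal(K/F), σ x = x) ∨ u i ∈ F⟮x⟯ := by
  -- This is the maximality of a point stabiliser in the symmetric group, done by hand: if τ fixes x
  -- but moves u i, then any σ moving u i is ρτκ with ρ and κ fixing u i, and all three fix x. If no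
  -- such τ exists, the Galois correspondence puts u i in F(x).
  by_cases h : ∃ τ : Gal(K/F), τ x = x ∧ τ (u i) ≠ u i
  · left
    obtain ⟨τ, hτx, hτ⟩ := h
    intro σ
    by_cases hσ : σ (u i) = u i
    · exact apply_eq_self_of_mem_adjoin_simple hx hσ
    have h1 : e τ i ≠ i := fun h => hτ (by rw [he, h])
    have h2 : e σ i ≠ i := fun h => hσ (by rw [he, h])
    -- `ρ` fixes `u i` and maps `τ (u i)` to `σ (u i)`
    set ρ := e.symm (Equiv.swap (e τ i) (e σ i)) with hρ
    have hρe : e ρ = Equiv.swap (e τ i) (e σ i) := e.apply_symm_apply _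
    have hρi : ρ (u i) = u i := by
      rw [he, hρe, Equiv.swap_apply_of_ne_of_ne h1.symm h2.symm]
    have hκ : ((ρ * τ)⁻¹ * σ) (u i) = u i := by
      have : σ (u i) = (ρ * τ) (u i) := by
        rw [AlgEquiv.mul_apply, he τ, he ρ, hρe, Equiv.swap_apply_left, he]
      rw [AlgEquiv.mul_apply, this, ← AlgEquiv.mul_apply, inv_mul_cancel, AlgEquiv.one_apply]
    have h3 := apply_eq_self_of_mem_adjoin_simple hx hκ
    have h4 : σ = (ρ * τ) * ((ρ * τ)⁻¹ * σ) := by group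
    rw [h4, AlgEquiv.mul_apply, h3, AlgEquiv.mul_apply, hτx]
    exact apply_eq_self_of_mem_adjoin_simple hx hρi
  · right
    push Not at h
    rw [← IsGalois.fixedField_fixingSubgroup F⟮x⟯, mem_fixedField_iff]
    intro τ hτ
    exact h τ ((mem_fixingSubgroup_iff _ _).1 hτ x (mem_adjoin_simple_self F x))

/-- Flipping the sign of the third square root does not affect the squared relations, so β² is a
root of p₁₂ too; it serves as the target of a conjugation. -/
theorem exists_second_snell_root : ∃ β : ℝ, 0 < β ∧ β < 1 ∧
    β / √(1 - β ^ 2) + 2 * (β / √(4 - β ^ 2)) - 3 * (β / √(9 - β ^ 2)) = 2 := by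
  set f : ℝ → ℝ := fun β => β / √(1 - β ^ 2) + 2 * (β / √(4 - β ^ 2)) - 3 * (β / √(9 - β ^ 2))
    with hf
  have hc : ContinuousOn f (Set.Icc 0 0.9) := fun x hx => by
    have h1 : √(1 - x ^ 2) ≠ 0 := (Real.sqrt_pos.2 (by nlinarith [hx.1, hx.2])).ne'
    have h2 : √(4 - x ^ 2) ≠ 0 := (Real.sqrt_pos.2 (by nlinarith [hx.1, hx.2])).ne'
    have h3 : √(9 - x ^ 2) ≠ 0 := (Real.sqrt_pos.2 (by nlinarith [hx.1, hx.2])).ne'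
    refine ContinuousAt.continuousWithinAt ?_
    fun_prop (disch := assumption)
  have h0 : f 0 < 2 := by simp [hf]
  have h9 : 2 < f 0.9 := by
    have h1 : √(1 - 0.9 ^ 2) ≤ (0.44 : ℝ) := Real.sqrt_le_iff.2 (by norm_num)
    have h2 : √(4 - 0.9 ^ 2) ≤ (1.8 : ℝ) := Real.sqrt_le_iff.2 (by norm_num)
    have h3 : (2.8 : ℝ) ≤ √(9 - 0.9 ^ 2) := Real.le_sqrt_of_sq_le (by norm_num)
    have p1 : (0 : ℝ) < √(1 - 0.9 ^ 2) := Real.sqrt_pos.2 (by norm_num)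
    have p2 : (0 : ℝ) < √(4 - 0.9 ^ 2) := Real.sqrt_pos.2 (by norm_num)
    have k1 : 0.9 / 0.44 ≤ (0.9 : ℝ) / √(1 - 0.9 ^ 2) := by gcongr
    have k2 : 0.9 / 1.8 ≤ (0.9 : ℝ) / √(4 - 0.9 ^ 2) := by gcongr
    have k3 : (0.9 : ℝ) / √(9 - 0.9 ^ 2) ≤ 0.9 / 2.8 := by gcongr
    simp only [hf]
    norm_num at k1 k2 k3 ⊢
    linarith
  obtain ⟨β, hβ, h⟩ := intermediate_value_Ioo (by norm_num) hc ⟨h0, h9⟩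
  exact ⟨β, hβ.1, by linarith [hβ.2], h⟩

/-- The real square roots in the Snell equation satisfy their defining equations. -/
theorem snell_sq_eq {α w : ℝ} (h0 : 0 < α) (h1 : α < 1) (hw : 1 ≤ w) :
    (w * (α / √(w ^ 2 - α ^ 2))) ^ 2 * (w ^ 2 - α ^ 2) = w ^ 2 * α ^ 2 := by
  have h : 0 < w ^ 2 - α ^ 2 := by nlinarith
  rw [mul_pow, div_pow, Real.sq_sqrt h.le]
  field_simp

theorem snellTriple_of_sum_eq {α : ℝ} (h0 : 0 < α) (h1 : α < 1) {ε₁ ε₂ ε₃ : ℝ} (e1 : ε₁ ^ 2 = 1)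
    (e2 : ε₂ ^ 2 = 1) (e3 : ε₃ ^ 2 = 1)
    (h : ε₁ * (α / √(1 - α ^ 2)) + ε₂ * (2 * (α / √(4 - α ^ 2))) +
      ε₃ * (3 * (α / √(9 - α ^ 2))) = 2) :
    SnellTriple (α ^ 2) (ε₁ * (α / √(1 - α ^ 2))) (ε₂ * (2 * (α / √(4 - α ^ 2))))
      (ε₃ * (3 * (α / √(9 - α ^ 2)))) where
  hx := by
    have := snell_sq_eq h0 h1 le_rfl
    norm_num at this
    rw [mul_pow, e1, one_mul, this]
  hy := by
    have := snell_sq_eq h0 h1 (by norm_num : (1 : ℝ) ≤ 2)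
    norm_num at this
    rw [mul_pow, e2, one_mul, this]
  hz := by
    have := snell_sq_eq h0 h1 (by norm_num : (1 : ℝ) ≤ 3)
    norm_num at this
    rw [mul_pow, e3, one_mul, this]
  sum_eq := h

theorem SnellTriple.map {F L : Type*} [Field F] [Field L] (φ : F →+* L) {a x y z : F}
    (h : SnellTriple a x y z) : SnellTriple (φ a) (φ x) (φ y) (φ z) where
  hx := by simpa only [map_mul, map_pow, map_sub, map_add, map_one, map_ofNat] using congrArg φ h.hx
  hy := by simpa only [map_mul, map_pow, map_sub, map_add, map_one, map_ofNat] using congrArg φ h.hy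
  hz := by simpa only [map_mul, map_pow, map_sub, map_add, map_one, map_ofNat] using congrArg φ h.hz
  sum_eq := by simpa only [map_mul, map_pow, map_sub, map_add, map_one, map_ofNat] using congrArg φ h.sum_eq

/-- The product of the sine and the weighted length, as a rational expression. -/
def scaledLength {F : Type*} [Field F] (a x y z : F) : F :=
  a / x + 4 * a / y + 9 * a / z + 2 * a

theorem map_scaledLength {F L : Type*} [Field F] [Field L] (φ : F →+* L) (a x y z : F) :
    φ (scaledLength a x y z) = scaledLength (φ a) (φ x) (φ y) (φ z) := by
  simp only [scaledLength, map_add, map_mul, map_div₀, map_ofNat]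

/-- Each term comes from α√(w² − α²) = α²/(α/√(w² − α²)), a sign being its own inverse. The factor α
makes the length rational in α² and the three Snell terms. -/
theorem scaledLength_eq {α : ℝ} (h0 : 0 < α) (h1 : α < 1) {ε₁ ε₂ ε₃ : ℝ} (e1 : ε₁ ^ 2 = 1)
    (e2 : ε₂ ^ 2 = 1) (e3 : ε₃ ^ 2 = 1) :
    scaledLength (α ^ 2) (ε₁ * (α / √(1 - α ^ 2))) (ε₂ * (2 * (α / √(4 - α ^ 2))))
      (ε₃ * (3 * (α / √(9 - α ^ 2)))) =
    α * (ε₁ * √(1 - α ^ 2) + ε₂ * (2 * √(4 - α ^ 2)) + ε₃ * (3 * √(9 - α ^ 2)) + 2 * α) := by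
  have p1 : 0 < √(1 - α ^ 2) := Real.sqrt_pos.2 (by nlinarith)
  have p2 : 0 < √(4 - α ^ 2) := Real.sqrt_pos.2 (by nlinarith)
  have p3 : 0 < √(9 - α ^ 2) := Real.sqrt_pos.2 (by nlinarith)
  have inv_eq : ∀ ε : ℝ, ε ^ 2 = 1 → ε⁻¹ = ε := fun ε h => by
    rw [inv_eq_iff_eq_inv]
    exact eq_inv_of_mul_eq_one_left (by rw [← h]; ring)
  have key : ∀ ε w g : ℝ, ε ^ 2 = 1 → 0 < w → 0 < g →
      w ^ 2 * α ^ 2 / (ε * (w * (α / g))) = α * (ε * (w * g)) := fun ε w g he hw hg => by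
    rw [div_mul_eq_div_div, div_eq_mul_inv _ ε, inv_eq ε he]
    field_simp
  have k1 := key ε₁ 1 _ e1 one_pos p1
  have k2 := key ε₂ 2 _ e2 two_pos p2
  have k3 := key ε₃ 3 _ e3 three_pos p3
  norm_num at k1 k2 k3
  rw [scaledLength, k1, k2, k3]
  ring

end

/-! ### The weighted distance is not expressible by radicals. -/

section

open IntermediateField

theorem SnellTriple.of_map {F L : Type*} [Field F] [Field L] {φ : F →+* L} {a x y z : F}
    (h : SnellTriple (φ a) (φ x) (φ y) (φ z)) : SnellTriple a x y z where
  hx := φ.injective (by simpa only [map_mul, map_pow, map_sub, map_one] using h.hx)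
  hy := φ.injective (by simpa only [map_mul, map_pow, map_sub, map_ofNat] using h.hy)
  hz := φ.injective (by simpa only [map_mul, map_pow, map_sub, map_ofNat] using h.hz)
  sum_eq := φ.injective (by simpa only [map_add, map_ofNat] using h.sum_eq)

/-- With C = 4 + r² − p² − q², squaring 2pq = C − 4r gives an equation in which r occurs to an odd
power only in 8Cr. So r is rational in the squares when C ≠ 0. -/
theorem SnellTriple.mem {F L : Type*} [Field F] [Field L] [CharZero L] [Algebra F L]
    {M : IntermediateField F L} {a x y z : L} (h : SnellTriple a x y z) (ha : a ∈ M)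
    (h1 : 1 - a ≠ 0) (h4 : 4 - a ≠ 0) (h9 : 9 - a ≠ 0)
    (hA : 4 + z ^ 2 - x ^ 2 - y ^ 2 ≠ 0) (hB : 4 + x ^ 2 - y ^ 2 - z ^ 2 ≠ 0) :
    x ∈ M ∧ y ∈ M ∧ z ∈ M := by
  have hx2 : x ^ 2 ∈ M := by
    rw [show x ^ 2 = a / (1 - a) by rw [eq_div_iff h1, h.hx]]
    exact div_mem ha (sub_mem (one_mem M) ha)
  have hy2 : y ^ 2 ∈ M := by
    rw [show y ^ 2 = 4 * a / (4 - a) by rw [eq_div_iff h4, h.hy]]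
    exact div_mem (mul_mem (ofNat_mem M 4) ha) (sub_mem (ofNat_mem M 4) ha)
  have hz2 : z ^ 2 ∈ M := by
    rw [show z ^ 2 = 9 * a / (9 - a) by rw [eq_div_iff h9, h.hz]]
    exact div_mem (mul_mem (ofNat_mem M 9) ha) (sub_mem (ofNat_mem M 9) ha)
  have key : ∀ p q r : L, p + q + r = 2 → 4 + r ^ 2 - p ^ 2 - q ^ 2 ≠ 0 → p ^ 2 ∈ M → q ^ 2 ∈ M →
      r ^ 2 ∈ M → r ∈ M := fun p q r hs hne hp hq hr => by
    have e1 : 2 * p * q = (4 + r ^ 2 - p ^ 2 - q ^ 2) - 4 * r := by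
      have : p + q = 2 - r := by linear_combination hs
      linear_combination (p + q + 2 - r) * this
    have e2 : r = ((4 + r ^ 2 - p ^ 2 - q ^ 2) ^ 2 + 16 * r ^ 2 - 4 * p ^ 2 * q ^ 2) /
        (8 * (4 + r ^ 2 - p ^ 2 - q ^ 2)) := by
      rw [eq_div_iff (mul_ne_zero (by norm_num) hne)]
      linear_combination (2 * p * q + ((4 + r ^ 2 - p ^ 2 - q ^ 2) - 4 * r)) * e1
    have hC : 4 + r ^ 2 - p ^ 2 - q ^ 2 ∈ M :=
      sub_mem (sub_mem (add_mem (ofNat_mem M 4) hr) hp) hq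
    rw [e2]
    exact div_mem (sub_mem (add_mem (pow_mem hC 2) (mul_mem (ofNat_mem M 16) hr))
      (mul_mem (mul_mem (ofNat_mem M 4) hp) hq)) (mul_mem (ofNat_mem M 8) hC)
  have hz := key x y z h.sum_eq hA hx2 hy2 hz2
  have hx := key y z x (by linear_combination h.sum_eq) (fun h => hB (by linear_combination h))
    hy2 hz2 hx2
  refine ⟨hx, ?_, hz⟩
  rw [show y = 2 - x - z by linear_combination h.sum_eq]
  exact sub_mem (sub_mem (ofNat_mem M 2) hx) hz

theorem snellLength_gt {α : ℝ} (h0 : 0 < α) (h1 : α < 1) : 6 < snellLength α := by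
  have g1 := Real.sqrt_nonneg (1 - α ^ 2)
  have g2 : 1 ≤ √(4 - α ^ 2) := Real.le_sqrt_of_sq_le (by nlinarith)
  have g3 : 2 ≤ √(9 - α ^ 2) := Real.le_sqrt_of_sq_le (by nlinarith)
  unfold snellLength
  linarith

/-- The negative third term dominates: the conjugate value lies strictly between −6 and 0, while the
true length exceeds 6. -/
theorem conjugate_length_sq_lt {α β : ℝ} (h0 : 0 < α) (h1 : α < 1) (hβ0 : 0 < β) (hβ1 : β < 1) :
    (1 * √(1 - β ^ 2) + 1 * (2 * √(4 - β ^ 2)) + -1 * (3 * √(9 - β ^ 2)) + 2 * β) ^ 2 <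
      snellLength α ^ 2 := by
  have hb : β ^ 2 < 1 := by nlinarith
  have hb0 : 0 ≤ β ^ 2 := sq_nonneg β
  have g1 : √(1 - β ^ 2) ≤ 1 := Real.sqrt_le_iff.2 ⟨by norm_num, by linarith⟩
  have g1' := Real.sqrt_nonneg (1 - β ^ 2)
  have g2 : √(4 - β ^ 2) ≤ 2 := Real.sqrt_le_iff.2 ⟨by norm_num, by linarith⟩
  have g2' : 1.7 ≤ √(4 - β ^ 2) := Real.le_sqrt_of_sq_le (by linarith)
  have g3 : √(9 - β ^ 2) ≤ 3 := Real.sqrt_le_iff.2 ⟨by norm_num, by linarith⟩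
  have g3' : 2.8 ≤ √(9 - β ^ 2) := Real.le_sqrt_of_sq_le (by linarith)
  have hlen := snellLength_gt h0 h1
  exact sq_lt_sq' (by linarith) (by linarith)

/-- The conjugate of the squared weighted length at a second real root differs from it. -/
theorem conjugate_length_ne {α β : ℝ} (h0 : 0 < α) (h1 : α < 1) (hβ0 : 0 < β) (hβ1 : β < 1)
    (hβ : β / √(1 - β ^ 2) + 2 * (β / √(4 - β ^ 2)) - 3 * (β / √(9 - β ^ 2)) = 2)
    {x y z : ℂ} (h : SnellTriple ((β ^ 2 : ℝ) : ℂ) x y z) :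
    scaledLength ((β ^ 2 : ℝ) : ℂ) x y z ^ 2 / ((β ^ 2 : ℝ) : ℂ) ≠
      ((snellLength α ^ 2 : ℝ) : ℂ) := by
  have p1 : 0 < √(1 - β ^ 2) := Real.sqrt_pos.2 (by nlinarith)
  have p2 : 0 < √(4 - β ^ 2) := Real.sqrt_pos.2 (by nlinarith)
  have p3 : 0 < √(9 - β ^ 2) := Real.sqrt_pos.2 (by nlinarith)
  -- The transported terms x, y, z are known only through their squares, so each is a real Snell
  -- term up to sign.
  have sign : ∀ (w : ℝ) (c : ℂ), 1 ≤ w → c ^ 2 * ((w ^ 2 - β ^ 2 : ℝ) : ℂ) = ((w ^ 2 * β ^ 2 : ℝ) : ℂ) →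
      ∃ ε : ℝ, ε ^ 2 = 1 ∧ c = ((ε * (w * (β / √(w ^ 2 - β ^ 2))) : ℝ) : ℂ) := fun w c hw hc => by
    have hne : ((w ^ 2 - β ^ 2 : ℝ) : ℂ) ≠ 0 := by
      exact_mod_cast (show (0 : ℝ) < w ^ 2 - β ^ 2 by nlinarith).ne'
    have hsq : c ^ 2 = ((w * (β / √(w ^ 2 - β ^ 2)) : ℝ) : ℂ) ^ 2 := by
      apply mul_right_cancel₀ hne
      rw [hc, ← snell_sq_eq hβ0 hβ1 hw]
      push_cast
      ring
    rcases sq_eq_sq_iff_eq_or_eq_neg.1 hsq with h | h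
    · exact ⟨1, by norm_num, by rw [h, one_mul]⟩
    · exact ⟨-1, by norm_num, by rw [h]; push_cast; ring⟩
  obtain ⟨ε₁, e1, rfl⟩ := sign 1 x le_rfl (by have := h.hx; push_cast at this ⊢; simpa using this)
  obtain ⟨ε₂, e2, rfl⟩ := sign 2 y (by norm_num)
    (by have := h.hy; push_cast at this ⊢; norm_num; exact this)
  obtain ⟨ε₃, e3, rfl⟩ := sign 3 z (by norm_num)
    (by have := h.hz; push_cast at this ⊢; norm_num; exact this)
  have hsum := h.sum_eq
  clear h
  norm_num only [one_pow, one_mul, show (2 : ℝ) ^ 2 = 4 by norm_num,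
    show (3 : ℝ) ^ 2 = 9 by norm_num] at hsum ⊢
  have hs : ε₁ * (β / √(1 - β ^ 2)) + ε₂ * (2 * (β / √(4 - β ^ 2))) +
      ε₃ * (3 * (β / √(9 - β ^ 2))) = 2 := by exact_mod_cast hsum
  have hL := scaledLength_eq hβ0 hβ1 e1 e2 e3
  intro heq
  have hreal : scaledLength (β ^ 2) (ε₁ * (β / √(1 - β ^ 2))) (ε₂ * (2 * (β / √(4 - β ^ 2))))
      (ε₃ * (3 * (β / √(9 - β ^ 2)))) ^ 2 / β ^ 2 = snellLength α ^ 2 := by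
    have hm := map_scaledLength Complex.ofRealHom (β ^ 2) (ε₁ * (β / √(1 - β ^ 2)))
      (ε₂ * (2 * (β / √(4 - β ^ 2)))) (ε₃ * (3 * (β / √(9 - β ^ 2))))
    simp only [Complex.ofRealHom_eq_coe] at hm
    rw [← hm] at heq
    exact_mod_cast heq
  rw [hL, mul_pow, mul_div_cancel_left₀ _ (by positivity)] at hreal
  set X₁ := β / √(1 - β ^ 2) with hX₁
  set X₂ := 2 * (β / √(4 - β ^ 2)) with hX₂
  set X₃ := 3 * (β / √(9 - β ^ 2)) with hX₃
  have q3 : 0 < X₃ := by positivity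
  have q23 : X₃ < X₂ := by
    have : 3 * √(4 - β ^ 2) < 2 * √(9 - β ^ 2) := by
      refine lt_of_pow_lt_pow_left₀ 2 (by positivity) ?_
      rw [mul_pow, mul_pow, Real.sq_sqrt (by nlinarith), Real.sq_sqrt (by nlinarith)]
      nlinarith
    rw [hX₃, hX₂, ← mul_div_assoc, ← mul_div_assoc, div_lt_div_iff₀ p3 p2]
    nlinarith
  have q12 : X₂ < X₁ := by
    have : 2 * √(1 - β ^ 2) < √(4 - β ^ 2) := by
      refine lt_of_pow_lt_pow_left₀ 2 (by positivity) ?_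
      rw [mul_pow, Real.sq_sqrt (by nlinarith), Real.sq_sqrt (by nlinarith)]
      nlinarith
    rw [hX₁, hX₂, ← mul_div_assoc, div_lt_div_iff₀ p2 p1]
    nlinarith
  -- Since X₁ > X₂ > X₃ > 0 and X₁ + X₂ − X₃ = 2, no other choice of signs gives the sum 2.
  have hsigns : ε₁ = 1 ∧ ε₂ = 1 ∧ ε₃ = -1 := by
    rcases sq_eq_sq_iff_eq_or_eq_neg.1 (e1.trans (one_pow 2).symm) with rfl | rfl <;>
    rcases sq_eq_sq_iff_eq_or_eq_neg.1 (e2.trans (one_pow 2).symm) with rfl | rfl <;>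
    rcases sq_eq_sq_iff_eq_or_eq_neg.1 (e3.trans (one_pow 2).symm) with rfl | rfl <;>
    first
      | exact ⟨rfl, rfl, rfl⟩
      | (exfalso; linarith)
  obtain ⟨rfl, rfl, rfl⟩ := hsigns
  refine absurd hreal (conjugate_length_sq_lt h0 h1 hβ0 hβ1).ne

theorem aeval_p12_of_real {α x y z : ℝ} (h0 : 0 < α) (h1 : α < 1)
    (h : SnellTriple (α ^ 2) x y z) : aeval (α ^ 2) p12 = 0 :=
  aeval_p12_of_snell (by nlinarith) (by nlinarith) (by nlinarith) h

theorem aeval_ofReal_p12 {a : ℝ} (h : aeval a p12 = 0) : aeval (a : ℂ) p12 = 0 := by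
  have := congrArg (Complex.ofRealHom.toRatAlgHom) h
  rw [← aeval_algHom_apply, map_zero] at this
  exact this

theorem exists_apply_root_eq {K : Type} [Field K] [Algebra ℚ K] [IsSplittingField ℚ K p12]
    {u : Fin 12 → K} (hroot : ∀ t, aeval t p12 = 0 ↔ ∃ i, t = u i) (φ : K →ₐ[ℚ] ℂ) {a : ℂ}
    (ha : aeval a p12 = 0) : ∃ i, φ (u i) = a := by
  obtain ⟨v, hv⟩ := exists_p12_eq_prod K
  have h : p12.map (algebraMap ℚ K) = 25 * ∏ i, (X - C (v i)) := by
    have : CharZero K := charZero_of_injective_algebraMap (algebraMap ℚ K).injective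
    refine Polynomial.funext fun t => ?_
    rw [eval_map_algebraMap, hv, eval_mul, eval_prod]
    simp
  have h2 := congrArg (eval₂ (φ : K →+* ℂ) a) h
  rw [eval₂_map, AlgHom.comp_algebraMap, ← aeval_def, ha, eval₂_mul, eval₂_finsetProd] at h2
  have h25 : eval₂ (φ : K →+* ℂ) a 25 = 25 := map_ofNat (eval₂RingHom (φ : K →+* ℂ) a) 25
  rw [h25, zero_eq_mul, or_iff_right (by norm_num), Finset.prod_eq_zero_iff] at h2
  obtain ⟨i, -, hi⟩ := h2
  simp only [eval₂_sub, eval₂_X, eval₂_C, sub_eq_zero] at hi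
  obtain ⟨j, hj⟩ := (hroot (v i)).1 (by
    rw [hv, Finset.prod_eq_zero (Finset.mem_univ i) (sub_self _), mul_zero])
  exact ⟨j, by rw [← hj, hi]; rfl⟩

theorem snellLength_notMem_solvableByRad_of_splittingField (K : Type) [Field K] [Algebra ℚ K]
    [IsSplittingField ℚ K p12] {α : ℝ} (h0 : 0 < α) (h1 : α < 0.7)
    (hsum : α / √(1 - α ^ 2) + 2 * (α / √(4 - α ^ 2)) + 3 * (α / √(9 - α ^ 2)) = 2) :
    ((snellLength α : ℝ) : ℂ) ∉ solvableByRad ℚ ℂ := by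
  intro hD
  have hα1 : α < 1 := by linarith
  have : Normal ℚ K := Normal.of_isSplittingField p12
  have : IsGalois ℚ K := ⟨⟩
  have : FiniteDimensional ℚ K := IsSplittingField.finiteDimensional K p12
  obtain ⟨u, e, hu, hroot, he⟩ := exists_gal_mulEquiv_perm K
  let φ : K →ₐ[ℚ] ℂ := IsSplittingField.lift K p12 (IsAlgClosed.splits _)
  set x := α / √(1 - α ^ 2) with hx
  set y := 2 * (α / √(4 - α ^ 2)) with hy
  set z := 3 * (α / √(9 - α ^ 2)) with hz
  have ht : SnellTriple (α ^ 2) x y z := by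
    simpa using snellTriple_of_sum_eq h0 hα1 (ε₁ := 1) (ε₂ := 1) (ε₃ := 1) (by norm_num)
      (by norm_num) (by norm_num) (by simpa using hsum)
  have hL : scaledLength (α ^ 2) x y z = α * snellLength α := by
    have := scaledLength_eq h0 hα1 (ε₁ := 1) (ε₂ := 1) (ε₃ := 1) (by norm_num)
      (by norm_num) (by norm_num)
    simpa [snellLength] using this
  obtain ⟨β, hβ0, hβ1, hβ⟩ := exists_second_snell_root
  have htβ := snellTriple_of_sum_eq hβ0 hβ1 (ε₁ := 1) (ε₂ := 1) (ε₃ := -1) (by norm_num)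
      (by norm_num) (by norm_num) (by linarith)
  obtain ⟨i, hi⟩ := exists_apply_root_eq hroot φ (aeval_ofReal_p12 (aeval_p12_of_real h0 hα1 ht))
  obtain ⟨j, hj⟩ := exists_apply_root_eq hroot φ (aeval_ofReal_p12 (aeval_p12_of_real hβ0 hβ1 htβ))
  have htC := ht.map Complex.ofRealHom
  simp only [Complex.ofRealHom_eq_coe] at htC
  have haM : ((α ^ 2 : ℝ) : ℂ) ∈ (ℚ⟮u i⟯).map φ := hi ▸ ⟨u i, mem_adjoin_simple_self ℚ (u i), rfl⟩
  -- The bound α < 0.7 serves to make x², y², z² less than 1, so that the denominators in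
  -- `SnellTriple.mem` are positive.
  have ha : α ^ 2 < 0.49 := by nlinarith
  have sq_lt_one : ∀ {c w : ℝ}, 1 ≤ w → c ^ 2 * (w - α ^ 2) = w * α ^ 2 → c ^ 2 < 1 :=
    fun hw hc => by
      by_contra! h
      nlinarith
  have hx2 : x ^ 2 < 1 := sq_lt_one le_rfl (by linarith [ht.hx])
  have hy2 : y ^ 2 < 1 := sq_lt_one (w := 4) (by norm_num) ht.hy
  have hz2 : z ^ 2 < 1 := sq_lt_one (w := 9) (by norm_num) ht.hz
  obtain ⟨hxM, hyM, hzM⟩ := htC.mem haM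
    (by exact_mod_cast (show (0 : ℝ) < 1 - α ^ 2 by nlinarith).ne')
    (by exact_mod_cast (show (0 : ℝ) < 4 - α ^ 2 by nlinarith).ne')
    (by exact_mod_cast (show (0 : ℝ) < 9 - α ^ 2 by nlinarith).ne')
    (by exact_mod_cast (show (0 : ℝ) < 4 + z ^ 2 - x ^ 2 - y ^ 2 by linarith [sq_nonneg z]).ne')
    (by exact_mod_cast (show (0 : ℝ) < 4 + x ^ 2 - y ^ 2 - z ^ 2 by linarith [sq_nonneg x]).ne')
  obtain ⟨x₀, hx₀, hxx⟩ := hxM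
  obtain ⟨y₀, hy₀, hyy⟩ := hyM
  obtain ⟨z₀, hz₀, hzz⟩ := hzM
  change φ x₀ = _ at hxx
  change φ y₀ = _ at hyy
  change φ z₀ = _ at hzz
  -- The preimage of D² in K. The square is taken because only α² and αD, not D itself, are known to
  -- lie in the image of K.
  set δ : K := scaledLength (u i) x₀ y₀ z₀ ^ 2 / u i with hδ
  have hmap : ∀ ψ : K →ₐ[ℚ] ℂ,
      ψ δ = scaledLength (ψ (u i)) (ψ x₀) (ψ y₀) (ψ z₀) ^ 2 / ψ (u i) := fun ψ => by
    rw [hδ, map_div₀, map_pow]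
    exact congrArg (· ^ 2 / ψ (u i)) (map_scaledLength (ψ : K →+* ℂ) _ _ _ _)
  have hφδ : φ δ = ((snellLength α ^ 2 : ℝ) : ℂ) := by
    have hm := map_scaledLength Complex.ofRealHom (α ^ 2) x y z
    simp only [Complex.ofRealHom_eq_coe] at hm
    rw [hmap, hi, hxx, hyy, hzz, ← hm, hL, ← Complex.ofReal_pow, ← Complex.ofReal_div, mul_pow,
      mul_div_cancel_left₀ _ (by positivity)]
  have hu_mem := mem_adjoin_simple_self ℚ (u i)
  have hδmem : δ ∈ ℚ⟮u i⟯ := by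
    refine div_mem (pow_mem ?_ 2) hu_mem
    exact add_mem (add_mem (add_mem (div_mem hu_mem hx₀)
      (div_mem (mul_mem (ofNat_mem _ 4) hu_mem) hy₀))
      (div_mem (mul_mem (ofNat_mem _ 9) hu_mem) hz₀)) (mul_mem (ofNat_mem _ 2) hu_mem)
  have htK : SnellTriple (u i) x₀ y₀ z₀ :=
    .of_map (φ := (φ : K →+* ℂ)) (by simpa only [RingHom.coe_coe, hi, hxx, hyy, hzz] using htC)
  rcases fixed_or_mem_adjoin e he hδmem with hfix | hgen
  -- If δ were fixed, the transposition taking α² to β² would preserve D², contradicting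
  -- `conjugate_length_ne`.
  · set σ := e.symm (Equiv.swap i j) with hσ
    have hσi : σ (u i) = u j := by
      rw [he, hσ, e.apply_symm_apply, Equiv.swap_apply_left]
    have h1 := hmap (φ.comp (σ : K →ₐ[ℚ] K))
    have h2 : (φ.comp (σ : K →ₐ[ℚ] K)) (u i) = ((β ^ 2 : ℝ) : ℂ) :=
      (congrArg φ hσi).trans hj
    have h3 : (φ.comp (σ : K →ₐ[ℚ] K)) δ = ((snellLength α ^ 2 : ℝ) : ℂ) :=
      (congrArg φ (hfix σ)).trans hφδ
    rw [h2, h3] at h1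
    have h4 := htK.map ((φ.comp (σ : K →ₐ[ℚ] K)) : K →+* ℂ)
    simp only [RingHom.coe_coe, h2] at h4
    exact conjugate_length_ne h0 hα1 hβ0 hβ1 hβ h4 h1.symm
  · have h1 : φ (u i) ∈ (ℚ⟮δ⟯).map φ := ⟨u i, hgen, rfl⟩
    rw [adjoin_map, Set.image_singleton, hφδ, hi] at h1
    have h2 : ℚ⟮((snellLength α ^ 2 : ℝ) : ℂ)⟯ ≤ solvableByRad ℚ ℂ := by
      rw [adjoin_simple_le_iff]
      push_cast
      exact pow_mem hD 2
    exact notMem_solvableByRad_of_aeval_p12 (aeval_ofReal_p12 (aeval_p12_of_real h0 hα1 ht))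
      (h2 h1)

end

/-! ### Conclusions for the bends, the distance and the problem. -/

theorem snellLength_notMem_solvableByRad {α : ℝ} (h0 : 0 < α) (h1 : α < 0.7)
    (hα : snellPhi α = 2) : ((snellLength α : ℝ) : ℂ) ∉ solvableByRad ℚ ℂ :=
  @snellLength_notMem_solvableByRad_of_splittingField p12.SplittingField _ _
    (IsSplittingField.splittingField p12) α h0 h1 (by rw [← snellPhi_eq, hα])

theorem sq_mem_solvableByRad_of_firstBend {α : ℝ} (h0 : 0 < α) (h1 : α < 1)
    (h : ((firstBend α 1 : ℝ) : ℂ) ∈ solvableByRad ℚ ℂ) :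
    ((α ^ 2 : ℝ) : ℂ) ∈ solvableByRad ℚ ℂ := by
  have hx : firstBend α 1 = α / √(1 - α ^ 2) := rfl
  rw [hx] at h
  have ht := snell_sq_eq h0 h1 le_rfl
  norm_num at ht
  set x := α / √(1 - α ^ 2)
  have hp : 0 < 1 + x ^ 2 := by positivity
  have : α ^ 2 = x ^ 2 / (1 + x ^ 2) := by
    rw [eq_div_iff hp.ne']
    linear_combination -ht
  rw [this]
  push_cast
  exact div_mem (pow_mem h 2) (add_mem (one_mem _) (pow_mem h 2))

/-- The ordinate of the second bend is 2 − z, where z is the rise of the last leg, and α² = 9z²/(9 +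
z²). -/
theorem sq_mem_solvableByRad_of_secondBend {α : ℝ} (h0 : 0 < α) (h1 : α < 1)
    (hα : snellPhi α = 2) (h : ((secondBend α 1 : ℝ) : ℂ) ∈ solvableByRad ℚ ℂ) :
    ((α ^ 2 : ℝ) : ℂ) ∈ solvableByRad ℚ ℂ := by
  have hz : secondBend α 1 = 2 - 3 * (α / √(9 - α ^ 2)) := by
    have := snellPhi_eq α
    rw [hα] at this
    have h2 : secondBend α 1 = α / √(1 - α ^ 2) + 2 * ((α / 2) / √(1 - (α / 2) ^ 2)) := rfl
    rw [h2, half_term]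
    linarith
  rw [hz] at h
  have ht := snell_sq_eq h0 h1 (by norm_num : (1 : ℝ) ≤ 3)
  norm_num at ht
  set z := 3 * (α / √(9 - α ^ 2))
  have hp : 0 < 9 + z ^ 2 := by positivity
  have h9 : α ^ 2 = 9 * z ^ 2 / (9 + z ^ 2) := by
    rw [eq_div_iff hp.ne']
    linear_combination -ht
  have hzm : (z : ℂ) ∈ solvableByRad ℚ ℂ := by
    have := sub_mem (ofNat_mem (solvableByRad ℚ ℂ) 2) h
    push_cast at this
    simpa using this
  rw [h9]
  push_cast
  exact div_mem (mul_mem (ofNat_mem _ 9) (pow_mem hzm 2)) (add_mem (ofNat_mem _ 9) (pow_mem hzm 2))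

theorem mainTheorem1 :
    (∃ α : ℝ,
      -- `α` is the unique solution of the Snell equation, and its square is a root of `p₁₂`
      (0.60206 < α ∧ α < 0.60208) ∧
      (∀ x : ℝ, 0 ≤ x → x < 1 → (snellPhi x = 2 ↔ x = α)) ∧
      aeval (α ^ 2) p12 = 0 ∧
      -- the shortest path is the chain with bends `u₁`, `u₂` determined by `α`; it is unique
      (∃ γ : Path stripInstance.s stripInstance.t, stripInstance.IsShortestPath γ ∧
        IsPolygonalChain γ
          ![stripInstance.s, firstBend α, secondBend α, stripInstance.t]) ∧
      (∀ γ : Path stripInstance.s stripInstance.t, stripInstance.IsShortestPath γ →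
        Set.range γ = segment ℝ stripInstance.s (firstBend α) ∪
          segment ℝ (firstBend α) (secondBend α) ∪
          segment ℝ (secondBend α) stripInstance.t) ∧
      -- neither `α`, nor its square, nor the positions of the bends are computable
      ¬ ACMQ (α : ℂ) ∧ ¬ ACMQ ((α ^ 2 : ℝ) : ℂ) ∧
      ¬ ACMQ ((firstBend α 1 : ℝ) : ℂ) ∧ ¬ ACMQ ((secondBend α 1 : ℝ) : ℂ)) ∧
    -- the Galois group
    Nonempty (p12.Gal ≃* Equiv.Perm (Fin 12)) ∧
    ¬ Group.IsSolvable (Equiv.Perm (Fin 12)) ∧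
    -- the instance, hence the problem, cannot be solved exactly within the model:
    -- neither the path nor its length can be computed
    ¬ stripInstance.IsExactlySolvable ∧
    ¬ ACMQ (stripInstance.weightedDist : ℂ) ∧
    ¬ (∀ I : WeightedRegionInstance, I.IsExactlySolvable) ∧
    ¬ (∀ I : WeightedRegionInstance, ACMQ (I.weightedDist : ℂ)) := by
  obtain ⟨α, hα, huniq⟩ := exists_snell_root
  have h0 : 0 < α := by linarith [hα.1]
  have h1 : α < 1 := by linarith [hα.2]
  have hφ : snellPhi α = 2 := (huniq α h0.le h1).2 rfl
  have hp12 : aeval (α ^ 2) p12 = 0 := by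
    refine aeval_p12_of_real h0 h1 (snellTriple_of_sum_eq h0 h1 (ε₁ := 1) (ε₂ := 1) (ε₃ := 1)
      (by norm_num) (by norm_num) (by norm_num) ?_)
    simpa [snellPhi_eq] using hφ
  have hsq : ((α ^ 2 : ℝ) : ℂ) ∉ solvableByRad ℚ ℂ :=
    notMem_solvableByRad_of_aeval_p12 (aeval_ofReal_p12 hp12)
  have hfirst : ¬ ACMQ ((firstBend α 1 : ℝ) : ℂ) := fun h =>
    hsq (sq_mem_solvableByRad_of_firstBend h0 h1 h.mem_solvableByRad)
  have hsolv := not_isExactlySolvable_of_firstBend h0 h1 hφ hfirst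
  have hdist : ¬ ACMQ (stripInstance.weightedDist : ℂ) := fun h => by
    rw [weightedDist_eq_snellLength h0 h1 hφ] at h
    exact snellLength_notMem_solvableByRad h0 (by linarith [hα.2]) hφ h.mem_solvableByRad
  refine ⟨⟨α, hα, huniq, hp12, ⟨snellPath α hφ, snellPath_isShortestPath h0 h1 hφ,
    snellPath_isPolygonalChain hφ⟩, fun γ hγ => ?_, fun h => hsq ?_,
    fun h => hsq h.mem_solvableByRad, hfirst, fun h => hsq ?_⟩, nonempty_gal_p12_mulEquiv_perm,
    not_isSolvable_perm_fin_twelve, hsolv, hdist, fun h => hsolv (h _), fun h => hdist (h _)⟩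
  · rw [range_eq_snellGraph h0 h1 hφ hγ, snellGraph_eq_union hφ]
  · push_cast
    exact pow_mem h.mem_solvableByRad 2
  · exact sq_mem_solvableByRad_of_secondBend h0 h1 hφ h.mem_solvableByRad
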